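/- **Proposition 3.5.** Let $X$ be a CAT$(-1)$ surface, that is, a complete smooth Riemannian manifold of dimension two without boundary whose Riemannian distance $d$ makes it a CAT$(-1)$ space: any two points are joined by a geodesic segment, and geodesic triangles are at least as thin as their comparison triangles in the hyperbolic plane of curvature $-1$. Fix $o\in X$. Let $\partial X$ be the set of classes of geodesic rays $[0,\infty)\to X$ at bounded distance from each other, on which the isometry group $\mathrm{Iso}(X)$ acts. For $\xi\in\partial X$ let $B_\xi(x,y)=\lim_{t\to\infty}\bigl(d(\alpha(t),x)-d(\alpha(t),y)\bigr)$, with $\alpha$ a geodesic ray ending at $\xi$. For $\xi\neq\xi'$ in $\partial X$ put $$(\xi|\xi')=\tfrac12\bigl(B_\xi(o,z)+B_{\xi'}(o,z)\bigr),\qquad d_{\partial X}(\xi,\xi')=e^{-(\xi|\xi')},$$ where $z$ is any point of the geodesic line connecting $\xi$ and $\xi'$, and put $d_{\partial X}(\xi,\xi)=0$ (Bourdon's visual metric). For a subgroup $G\leqslant \mathrm{Iso}(X)$ let $$\delta_G=\inf\Bigl\{s\in\mathbb R:\ \sum_{g\in G}e^{-s\,d(o,go)}<\infty\Bigr\}\in[-\infty,\infty].$$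 Let $p\in\mathrm{Iso}(X)$ be parabolic, meaning that $p$ has a unique fixed point in $\partial X$, and let $\xi\in\partial X$ be a point that is not fixed by $p$. Then, in $[-\infty,\infty]$, $$\liminf_{k\to\infty}\frac{\log k}{-\log d_{\partial X}(p^k\xi,p^{k+1}\xi)}\ \le\ \delta_{\langle p\rangle}\ \le\ \limsup_{k\to\infty}\frac{\log k}{-\log d_{\partial X}(p^k\xi,p^{k+1}\xi)} .$$ If the sequence $\left(\frac{\log k}{-\log d_{\partial X}(p^k\xi,p^{k+1}\xi)}\right)_k$ converges in $[-\infty,\infty]$ as $k\to\infty$, then $$\lim_{k\to\infty}\frac{\log k}{-\log d_{\partial X}(p^k\xi,p^{k+1}\xi)}=\delta_{\langle p\rangle}.$$ -/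

import Mathlib

open Filter Topology Bundle
open scoped Manifold ContDiff NNReal

noncomputable section

/-- A `CAT(-1)` space: a geodesic metric space whose geodesic triangles are at least as thin as
their comparison triangles in the hyperbolic plane of curvature `-1` (Mathlib's upper half-plane
with its hyperbolic distance).
In a geodesic space, `p` lies on some geodesic segment from `x` to `y` if and only if
`dist x p + dist p y = dist x y`. Two points on different sides of a triangle lie on two sides with
a common vertex, here called `x`. -/
structure IsCATNegOne (X : Type*) [MetricSpace X] : Prop where
  /-- Any two points are joined by a geodesic segment. -/
  exists_geodesic : ∀ x y : X, ∃ γ : ℝ → X, γ 0 = x ∧ γ (dist x y) = y ∧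
    ∀ s ∈ Set.Icc 0 (dist x y), ∀ t ∈ Set.Icc 0 (dist x y), dist (γ s) (γ t) = |s - t|
  /-- For a triangle `x y z` with comparison triangle `x' y' z'`, and points `p ∈ [x, y]`,
  `q ∈ [x, z]` with comparison points `p'`, `q'`, one has `d(p, q) ≤ d(p', q')`. -/
  comparison : ∀ (x y z : X) (x' y' z' : UpperHalfPlane),
    dist x' y' = dist x y → dist y' z' = dist y z → dist x' z' = dist x z →
    ∀ (p q : X) (p' q' : UpperHalfPlane),
      dist x p + dist p y = dist x y → dist x' p' = dist x p → dist p' y' = dist p y →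
      dist x q + dist q z = dist x z → dist x' q' = dist x q → dist q' z' = dist q z →
      dist p q ≤ dist p' q'

section Boundary

variable (X : Type*) [MetricSpace X]

/-- Geodesic rays, parametrized by arc length. -/
def GeodesicRay : Type _ := {c : ℝ≥0 → X // Isometry c}

/-- Two geodesic rays are asymptotic if they stay at bounded distance from each other. -/
def asymptoticSetoid : Setoid (GeodesicRay X) where
  r c c' := ∃ C : ℝ, ∀ t, dist (c.1 t) (c'.1 t) ≤ C
  iseqv :=
    { refl := fun c => ⟨0, fun t => by simp⟩
      symm := fun {c c'} h => by
        obtain ⟨C, hC⟩ := h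
        exact ⟨C, fun t => by rw [dist_comm]; exact hC t⟩
      trans := fun {c c' c''} h h' => by
        obtain ⟨C, hC⟩ := h
        obtain ⟨C', hC'⟩ := h'
        exact ⟨C + C', fun t =>
          (dist_triangle _ (c'.1 t) _).trans (add_le_add (hC t) (hC' t))⟩ }

/-- The boundary at infinity `∂X`: asymptoty classes of geodesic rays. -/
def GromovBoundary : Type _ := Quotient (asymptoticSetoid X)

variable {X}

/-- The endpoint at infinity of a geodesic ray. -/
def GeodesicRay.endpoint (c : GeodesicRay X) : GromovBoundary X :=
  Quotient.mk (asymptoticSetoid X) c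

/-- The image of a geodesic ray under an isometry. -/
def GeodesicRay.map (g : X ≃ᵢ X) (c : GeodesicRay X) : GeodesicRay X :=
  ⟨fun t => g (c.1 t), g.isometry.comp c.2⟩

/-- The action of the isometry group `Iso(X)` on `∂X`, `g [c] = [g ∘ c]`. -/
instance : MulAction (X ≃ᵢ X) (GromovBoundary X) where
  smul g := Quotient.map (sa := asymptoticSetoid X) (sb := asymptoticSetoid X)
    (GeodesicRay.map g) (fun c c' h => by
      obtain ⟨C, hC⟩ := h
      exact ⟨C, fun t => (g.isometry.dist_eq _ _).trans_le (hC t)⟩)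
  one_smul ξ := by
    induction ξ using Quotient.ind
    rfl
  mul_smul g h ξ := by
    induction ξ using Quotient.ind
    rfl

/-- The Busemann function `B_ξ(x, y) = lim_{t → ∞} (d(α(t), x) - d(α(t), y))`, where `α` is a
geodesic ray ending at `ξ`. The limit exists for every ray, and in a `CAT(-1)` space it does not
depend on the ray chosen in the class `ξ`. -/
def busemann (ξ : GromovBoundary X) (x y : X) : ℝ :=
  limUnder atTop (fun t : ℝ≥0 =>
    dist ((Quotient.out (s := asymptoticSetoid X) ξ).1 t) x
      - dist ((Quotient.out (s := asymptoticSetoid X) ξ).1 t) y)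

/-- The positive half of a geodesic line. -/
def forwardRay (γ : ℝ → X) (hγ : Isometry γ) : GeodesicRay X :=
  ⟨fun t => γ t, hγ.comp isometry_subtype_coe⟩

/-- The negative half of a geodesic line, with reversed parametrization. -/
def backwardRay (γ : ℝ → X) (hγ : Isometry γ) : GeodesicRay X :=
  ⟨fun t => γ (-(t : ℝ)), hγ.comp ((IsometryEquiv.neg ℝ).isometry.comp isometry_subtype_coe)⟩

/-- `z` lies on a geodesic line of `X` which connects `ξ` and `ξ'`. -/
def LiesOnGeodesic (ξ ξ' : GromovBoundary X) (z : X) : Prop :=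
  ∃ (γ : ℝ → X) (hγ : Isometry γ),
    (backwardRay γ hγ).endpoint = ξ ∧ (forwardRay γ hγ).endpoint = ξ' ∧ z ∈ Set.range γ

/-- The Gromov product `(ξ|ξ')_x = (B_ξ(x, z) + B_ξ'(x, z)) / 2`, where `z` is a point of the
geodesic which connects the distinct boundary points `ξ` and `ξ'`. -/
def gromovProduct (x : X) (ξ ξ' : GromovBoundary X) : ℝ :=
  let z : X := @Classical.epsilon X ⟨x⟩ (LiesOnGeodesic ξ ξ')
  (busemann ξ x z + busemann ξ' x z) / 2

open Classical in
/-- Bourdon's visual metric on `∂X` with reference point `o`. -/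
def visualDist (o : X) (ξ ξ' : GromovBoundary X) : ℝ :=
  if ξ = ξ' then 0 else Real.exp (-gromovProduct o ξ ξ')

/-- An isometry is parabolic if it has a unique fixed point in `∂X`. -/
def IsParabolicIsometry (p : X ≃ᵢ X) : Prop :=
  ∃! η : GromovBoundary X, p • η = η

/-- The critical exponent `δ_G = inf {s ∈ ℝ : ∑_{g ∈ G} e^{-s d(o, g o)} < ∞}`, as an extended
real number. -/
def criticalExponent (o : X) (G : Subgroup (X ≃ᵢ X)) : EReal :=
  sInf ((fun s : ℝ => (s : EReal)) ''
    {s : ℝ | Summable (fun g : G => Real.exp (-s * dist o ((g : X ≃ᵢ X) o)))})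

/-- The sequence `log k / (- log d_{∂X}(p^k ξ, p^{k+1} ξ))`. -/
def visualRatio (o : X) (p : X ≃ᵢ X) (ξ : GromovBoundary X) (k : ℕ) : ℝ :=
  Real.log k / (-Real.log (visualDist o (p ^ k • ξ) (p ^ (k + 1) • ξ)))

end Boundary

end

/-! ### Hyperbolic trigonometry -/

/-! Since `-log d_{∂X}` is the Gromov product, everything rests on the estimate `(p^k ξ | p^(k+1)
ξ)_o = d(o, p^k o) + O(1)`. By equivariance the left side is, up to a bounded error, `(a | p a)_x`
with `a` far out on a ray to `ξ` and `x = p^(-k) o`. Changing the base point from `x` to `o` gives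
`d(x, o)` plus the products `(a | p a)_o`, `(a | x)_o`, `(p a | x)_o`, and these are bounded because
`ξ ≠ p ξ` and `p` moves `p^(-k) o` by `d(o, p o)` only. This is
`GromovHyperbolic.abs_gromovProduct_pow_sub_dist_le`.

The ratio is therefore `log k / (d(o, p^k o) + O(1))`. As soon as `d(o, p^k o) → ∞`, comparison of
`∑ exp (-s d(o, p^k o))` with the harmonic series and with `∑ k^(-s/s')` gives the two inequalities
(`liminf_log_div_le`, `summable_of_limsup_log_div_lt`).

The divergence of the displacement is the geometric part (`IsCATNegOne.tendsto_dist_pow`).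
Otherwise, by Całka's theorem, the orbit is bounded and its circumcenter is fixed by `p`. A fixed
point `x` and the fixed boundary point `η` give a pointwise fixed ray from `x` to `η`. Near `x` the
space is almost Euclidean, so the almost antipodal points of fixed points are almost fixed, and then
there are fixed points close to them. Hence the fixed set continues past `x`, and a limit argument
gives a fixed ray opposite to the first one. Its endpoint is a second fixed point of `∂X`, which
contradicts the uniqueness of `η`.

All metric inputs (four point condition, convexity, uniqueness of segments and rays) come from one
consequence of the comparison axiom, `IsCATNegOne.stewart`. -/

theorem UpperHalfPlane.cosh_dist_exp_mul_I (z : UpperHalfPlane) (t : ℝ) :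
    Real.cosh (dist z ⟨⟨0, Real.exp t⟩, Real.exp_pos t⟩) =
      ((z.re ^ 2 + z.im ^ 2) * Real.exp (-t) + Real.exp t) / (2 * z.im) := by
  rw [UpperHalfPlane.cosh_dist']
  have hz := z.im_pos
  have ht := Real.exp_pos t
  have h1 : (⟨⟨0, Real.exp t⟩, Real.exp_pos t⟩ : UpperHalfPlane).re = 0 := rfl
  have h2 : (⟨⟨0, Real.exp t⟩, Real.exp_pos t⟩ : UpperHalfPlane).im = Real.exp t := rfl
  rw [h1, h2, Real.exp_neg]
  field_simp
  ring

theorem UpperHalfPlane.dist_exp_mul_I (s t : ℝ) :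
    dist (⟨⟨0, Real.exp s⟩, Real.exp_pos s⟩ : UpperHalfPlane)
      ⟨⟨0, Real.exp t⟩, Real.exp_pos t⟩ = |s - t| := by
  rw [UpperHalfPlane.dist_of_re_eq (by rfl), Real.dist_eq]
  show |Real.log (Real.exp s) - Real.log (Real.exp t)| = _
  simp

/-- Expand `(cosh c - cosh (a - b)) * (cosh (a + b) - cosh c) ≥ 0`. This is the form in which the
triangle inequalities enter the construction of a comparison triangle. -/
theorem Real.four_mul_cosh_quadratic_form_nonneg {a b c : ℝ} (ha : 0 ≤ a) (hb : 0 ≤ b)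
    (h1 : |a - b| ≤ c) (h2 : c ≤ a + b) :
    Real.cosh a ^ 2 + Real.cosh b ^ 2 + Real.sinh c ^ 2
      ≤ 2 * Real.cosh a * Real.cosh b * Real.cosh c := by
  have hc : 0 ≤ c := (abs_nonneg _).trans h1
  have e1 : Real.cosh (a - b) ≤ Real.cosh c := by
    rw [Real.cosh_le_cosh, abs_of_nonneg hc]; exact h1
  have e2 : Real.cosh c ≤ Real.cosh (a + b) := by
    rw [Real.cosh_le_cosh, abs_of_nonneg hc, abs_of_nonneg (by positivity)]; exact h2
  rw [Real.cosh_sub] at e1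
  rw [Real.cosh_add] at e2
  have ea := Real.cosh_sq a
  have eb := Real.cosh_sq b
  have ec := Real.cosh_sq c
  have e3 := mul_nonneg (sub_nonneg.2 e1) (sub_nonneg.2 e2)
  have e4 : (Real.sinh a * Real.sinh b) ^ 2 = (Real.cosh a ^ 2 - 1) * (Real.cosh b ^ 2 - 1) := by
    rw [mul_pow]; rw [ea, eb]; ring
  nlinarith

/-- Existence of a comparison triangle in the hyperbolic plane with one side on the
imaginary axis. -/
theorem UpperHalfPlane.exists_comparison {a b c : ℝ} (ha : 0 ≤ a) (hb : 0 ≤ b) (hc : 0 < c)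
    (h1 : |a - b| ≤ c) (h2 : c ≤ a + b) :
    ∃ z : UpperHalfPlane, dist z ⟨⟨0, Real.exp 0⟩, Real.exp_pos 0⟩ = a ∧
      dist z ⟨⟨0, Real.exp c⟩, Real.exp_pos c⟩ = b := by
  have hs : 0 < Real.sinh c := Real.sinh_pos_iff.2 hc
  have hq := Real.four_mul_cosh_quadratic_form_nonneg ha hb h1 h2
  have hee : Real.exp c * Real.exp (-c) = 1 := by rw [← Real.exp_add]; simp
  have hch : Real.cosh c = (Real.exp c + Real.exp (-c)) / 2 := Real.cosh_eq c
  have hsh : Real.sinh c = (Real.exp c - Real.exp (-c)) / 2 := Real.sinh_eq c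
  set A := Real.cosh a
  set B := Real.cosh b
  set E := Real.exp c
  set E' := Real.exp (-c)
  set S := Real.sinh c
  have hE : 0 < E := Real.exp_pos _
  have hE' : 0 < E' := Real.exp_pos _
  have hB : 1 ≤ B := Real.one_le_cosh b
  have hA : 1 ≤ A := Real.one_le_cosh a
  have hprod : S ^ 2 ≤ (B - A * E') * (A * E - B) := by
    have : (B - A * E') * (A * E - B) = A * B * (E + E') - A ^ 2 * (E * E') - B ^ 2 := by ring
    rw [this, hee]
    have : 2 * A * B * Real.cosh c = A * B * (E + E') := by rw [hch]; ring
    nlinarith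
  have hpos : 0 < (B - A * E') * (A * E - B) := lt_of_lt_of_le (by positivity) hprod
  have hα : 0 < B - A * E' := by
    by_contra hcon
    push Not at hcon
    have : A * E - B < 0 := by
      by_contra h'
      push Not at h'
      nlinarith
    have h3 : A * E < A * E' := by linarith
    have h4 : E' < E := by nlinarith
    nlinarith
  -- For the point `u + i v`, the cosh of the distance to `i e^t` is `(u² + v²)/(2v) e^(-t) + 1/(2v)
  -- e^t`. The values `A` at `t = 0` and `B` at `t = c` determine the coefficients: `α` of `e^t` and
  -- `A - α` of `e^(-t)`. Hence `v = 1/(2α)` and `u² = 2v(A - α) - v²`, which is nonnegative exactly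
  -- when `4α(A - α) ≥ 1`.
  set α := (B - A * E') / (2 * S) with hαdef
  have hα' : 0 < α := by positivity
  set v := 1 / (2 * α) with hv
  have hv' : 0 < v := by positivity
  have hβ : 0 ≤ 2 * v * (A - α) - v ^ 2 := by
    have h4 : 1 ≤ 4 * α * (A - α) := by
      have : A - α = (A * E - B) / (2 * S) := by
        rw [hαdef]; field_simp; rw [hsh]; ring
      rw [this, hαdef]
      rw [show 4 * ((B - A * E') / (2 * S)) * ((A * E - B) / (2 * S)) =
        ((B - A * E') * (A * E - B)) / S ^ 2 by field_simp; ring]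
      rw [le_div_iff₀ (by positivity)]
      linarith
    have : 2 * v * (A - α) - v ^ 2 = (4 * α * (A - α) - 1) / (4 * α ^ 2) := by
      rw [hv]; field_simp; ring
    rw [this]
    apply div_nonneg <;> nlinarith
  set u := Real.sqrt (2 * v * (A - α) - v ^ 2) with hu
  have hu2 : u ^ 2 = 2 * v * (A - α) - v ^ 2 := Real.sq_sqrt hβ
  have hinj : ∀ {s t : ℝ}, 0 ≤ s → 0 ≤ t → Real.cosh s = Real.cosh t → s = t := by
    intro s t hs ht h
    have := Real.cosh_strictMonoOn.injOn (Set.mem_Ici.2 hs) (Set.mem_Ici.2 ht) h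
    exact this
  have hvα : v * α = 1 / 2 := by rw [hv]; field_simp
  refine ⟨⟨⟨u, v⟩, hv'⟩, hinj dist_nonneg ha ?_, hinj dist_nonneg hb ?_⟩
  · rw [UpperHalfPlane.cosh_dist_exp_mul_I]
    show ((u ^ 2 + v ^ 2) * _ + _) / (2 * v) = A
    rw [hu2, div_eq_iff (by positivity)]
    simp
    linarith
  · rw [UpperHalfPlane.cosh_dist_exp_mul_I]
    show ((u ^ 2 + v ^ 2) * E' + E) / (2 * v) = B
    rw [hu2, div_eq_iff (by positivity)]
    have h5 : α * (E - E') = B - A * E' := by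
      have : E - E' = 2 * S := by linarith
      rw [this, hαdef]
      field_simp
    have : B * (2 * v) = 2 * v * (A * E' + α * (E - E')) := by rw [h5]; ring
    rw [this]
    linear_combination (-2) * E * hvα

/-- Along the imaginary axis the cosh of the distance to a fixed point has the form `α e^(-t) + β
e^t`; interpolation between two values of such a function is Stewart's theorem in the hyperbolic
plane. -/
theorem Real.sinh_mul_exp_form (α β a b : ℝ) :
    (α * Real.exp (-a) + β * Real.exp a) * Real.sinh (a + b) =
      Real.sinh b * (α + β) + Real.sinh a * (α * Real.exp (-(a + b)) + β * Real.exp (a + b)) := by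
  simp only [Real.sinh_eq, neg_add, Real.exp_add]
  have h1 : Real.exp a * Real.exp (-a) = 1 := by rw [← Real.exp_add]; simp
  have h2 : Real.exp b * Real.exp (-b) = 1 := by rw [← Real.exp_add]; simp
  linear_combination (α * Real.exp b / 2 - β * Real.exp (-b) / 2 + β * Real.exp b / 2
    - α * Real.exp (-b) / 2) * h1

/-! ### Stewart's inequality and the four point condition -/

section CAT

variable {X : Type*} [MetricSpace X]

/-- The hyperbolic Stewart inequality. -/
theorem IsCATNegOne.stewart (hX : IsCATNegOne X) {x y m : X} (z : X)
    (hm : dist x m + dist m y = dist x y) :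
    Real.cosh (dist z m) * Real.sinh (dist x y) ≤
      Real.sinh (dist m y) * Real.cosh (dist z x) + Real.sinh (dist x m) * Real.cosh (dist z y) := by
  rcases (dist_nonneg (x := x) (y := y)).eq_or_lt with h0 | h0
  · rw [← h0]
    simp only [Real.sinh_zero, mul_zero]
    have := Real.sinh_nonneg_iff.2 (dist_nonneg (x := m) (y := y))
    have := Real.sinh_nonneg_iff.2 (dist_nonneg (x := x) (y := m))
    positivity
  obtain ⟨w, hw1, hw2⟩ := UpperHalfPlane.exists_comparison (a := dist z x) (b := dist z y)
    dist_nonneg dist_nonneg h0 (abs_sub_le_iff.2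
      ⟨by linarith [dist_triangle z y x, dist_comm x y], by linarith [dist_triangle z x y]⟩)
    (by linarith [dist_triangle x z y, dist_comm x z])
  -- The vertex `z` counts as a point of the side `[x, z]`, so the comparison axiom bounds `d(m,
  -- z)`.
  have key := hX.comparison x y z ⟨⟨0, Real.exp 0⟩, Real.exp_pos 0⟩
    ⟨⟨0, Real.exp (dist x y)⟩, Real.exp_pos _⟩ w
    (by rw [UpperHalfPlane.dist_exp_mul_I]; simp)
    (by rw [dist_comm, hw2, dist_comm])
    (by rw [dist_comm, hw1, dist_comm])
    m z ⟨⟨0, Real.exp (dist x m)⟩, Real.exp_pos _⟩ w hm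
    (by rw [UpperHalfPlane.dist_exp_mul_I]; simp)
    (by rw [UpperHalfPlane.dist_exp_mul_I, ← hm]; simp)
    (by simp) (by rw [dist_comm, hw1, dist_comm]) (by simp)
  rw [dist_comm m z, dist_comm _ w] at key
  have k2 : Real.cosh (dist z m) ≤
      Real.cosh (dist w ⟨⟨0, Real.exp (dist x m)⟩, Real.exp_pos _⟩) := by
    rw [Real.cosh_le_cosh, abs_of_nonneg dist_nonneg, abs_of_nonneg dist_nonneg]
    exact key
  have hs : 0 ≤ Real.sinh (dist x y) := Real.sinh_nonneg_iff.2 h0.le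
  refine (mul_le_mul_of_nonneg_right k2 hs).trans (le_of_eq ?_)
  rw [← hw1, ← hw2, UpperHalfPlane.cosh_dist_exp_mul_I, UpperHalfPlane.cosh_dist_exp_mul_I,
    UpperHalfPlane.cosh_dist_exp_mul_I, ← hm]
  have := Real.sinh_mul_exp_form ((w.re ^ 2 + w.im ^ 2) / (2 * w.im)) (1 / (2 * w.im))
    (dist x m) (dist m y)
  simp only [neg_zero, Real.exp_zero]
  rw [add_div, add_div, add_div, mul_one]
  simp only [div_mul_eq_mul_div, one_mul] at this
  convert this using 1

theorem IsCATNegOne.exists_between (hX : IsCATNegOne X) (x y : X) {a : ℝ} (ha : 0 ≤ a)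
    (ha' : a ≤ dist x y) : ∃ m, dist x m = a ∧ dist m y = dist x y - a := by
  obtain ⟨γ, h0, h1, h⟩ := hX.exists_geodesic x y
  have hD : (0 : ℝ) ≤ dist x y := dist_nonneg
  refine ⟨γ a, ?_, ?_⟩
  · conv_lhs => rw [← h0]
    rw [h 0 ⟨le_rfl, hD⟩ a ⟨ha, ha'⟩]
    simp [abs_of_nonneg ha]
  · conv_lhs => rw [← h1]
    rw [h a ⟨ha, ha'⟩ _ ⟨hD, le_rfl⟩, abs_sub_comm, abs_of_nonneg (by linarith)]

/-- Bounds the weights in Stewart's inequality: `sinh d(m, y) / sinh d(x, y)` is at most `exp (-d(x,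
m))`. -/
theorem Real.sinh_le_exp_neg_mul_sinh_add {a : ℝ} (ha : 0 ≤ a) (b : ℝ) :
    Real.sinh b ≤ Real.exp (-a) * Real.sinh (a + b) := by
  simp only [Real.sinh_eq, neg_add, Real.exp_add]
  have h1 : Real.exp a * Real.exp (-a) = 1 := by rw [← Real.exp_add]; simp
  have h2 : Real.exp (-a) ≤ 1 := Real.exp_le_one_iff.2 (by linarith)
  have h3 := Real.exp_pos (-a)
  have h4 := Real.exp_pos (-b)
  have : Real.exp (-a) * ((Real.exp a * Real.exp b - Real.exp (-a) * Real.exp (-b)) / 2) =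
    (Real.exp b * (Real.exp a * Real.exp (-a)) - Real.exp (-a) ^ 2 * Real.exp (-b)) / 2 := by ring
  rw [this, h1]
  have h5 : Real.exp (-a) ^ 2 ≤ 1 := by nlinarith
  nlinarith

/-- Stewart's inequality with the exponential bounds on its weights gives `cosh d(z, m) ≤ 2 e^M`,
where `M` is the maximum. Passing from cosh to exp costs another factor 2, whence `2 log 2 = log 4`.
-/
theorem IsCATNegOne.dist_le_max (hX : IsCATNegOne X) {x y m : X} (z : X)
    (hm : dist x m + dist m y = dist x y) :
    dist z m ≤ max (dist z x - dist x m) (dist z y - dist m y) + 2 * Real.log 2 := by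
  have hlog : 0 ≤ Real.log 2 := Real.log_nonneg (by norm_num)
  rcases (dist_nonneg (x := x) (y := y)).eq_or_lt with h0 | h0
  · have h1 : dist x m = 0 := by
      linarith [dist_nonneg (x := x) (y := m), dist_nonneg (x := m) (y := y)]
    rw [h1, ← dist_eq_zero.1 h1]
    linarith [le_max_left (dist z x - 0) (dist z y - dist x y)]
  have hs : 0 < Real.sinh (dist x y) := Real.sinh_pos_iff.2 h0
  have hS := hX.stewart z hm
  have ha := Real.sinh_le_exp_neg_mul_sinh_add (dist_nonneg (x := x) (y := m)) (dist m y)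
  have hb := Real.sinh_le_exp_neg_mul_sinh_add (dist_nonneg (x := m) (y := y)) (dist x m)
  rw [hm] at ha
  rw [add_comm, hm] at hb
  set M := max (dist z x - dist x m) (dist z y - dist m y) with hM
  have hcosh : ∀ t : ℝ, 0 ≤ t → Real.cosh t ≤ Real.exp t := by
    intro t ht
    rw [Real.cosh_eq]
    have : Real.exp (-t) ≤ Real.exp t := Real.exp_le_exp.2 (by linarith)
    linarith
  have e1 : Real.exp (-dist x m) * Real.cosh (dist z x) ≤ Real.exp M := by
    refine (mul_le_mul_of_nonneg_left (hcosh _ dist_nonneg) (Real.exp_pos _).le).trans ?_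
    rw [← Real.exp_add, Real.exp_le_exp]
    linarith [le_max_left (dist z x - dist x m) (dist z y - dist m y)]
  have e2 : Real.exp (-dist m y) * Real.cosh (dist z y) ≤ Real.exp M := by
    refine (mul_le_mul_of_nonneg_left (hcosh _ dist_nonneg) (Real.exp_pos _).le).trans ?_
    rw [← Real.exp_add, Real.exp_le_exp]
    linarith [le_max_right (dist z x - dist x m) (dist z y - dist m y)]
  have e3 : Real.cosh (dist z m) * Real.sinh (dist x y) ≤
      (2 * Real.exp M) * Real.sinh (dist x y) := by
    refine hS.trans ?_
    have f1 := mul_le_mul_of_nonneg_right ha (Real.cosh_pos (dist z x)).le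
    have f2 := mul_le_mul_of_nonneg_right hb (Real.cosh_pos (dist z y)).le
    have f3 := mul_le_mul_of_nonneg_right e1 hs.le
    have f4 := mul_le_mul_of_nonneg_right e2 hs.le
    linarith
  have e4 := le_of_mul_le_mul_right e3 hs
  have e5 : Real.exp (dist z m) ≤ 4 * Real.exp M := by
    rw [Real.cosh_eq] at e4
    linarith [Real.exp_pos (-dist z m)]
  have e6 : (4 : ℝ) = Real.exp (2 * Real.log 2) := by
    rw [two_mul, Real.exp_add, Real.exp_log (by norm_num)]; norm_num
  rw [e6, ← Real.exp_add, Real.exp_le_exp] at e5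
  linarith

/-- `CAT(-1)` spaces are hyperbolic in the sense of Gromov (four point condition). -/
theorem IsCATNegOne.four_point (hX : IsCATNegOne X) (x y z w : X) :
    dist x z + dist y w ≤
      max (dist x y + dist z w) (dist x w + dist y z) + 4 * Real.log 2 := by
  -- This choice of `m` on `[x, z]` makes both terms of the maximum for `y` equal, so no case
  -- distinction is needed there. Then `d(y, w)` is bounded through `m`.
  set a := (dist x z + dist y x - dist y z) / 2 with ha
  obtain ⟨m, h1, h2⟩ := hX.exists_between x z (a := a)
    (by linarith [dist_triangle y x z]) (by linarith [dist_triangle y z x, dist_comm x z])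
  have hy := hX.dist_le_max y (x := x) (y := z) (m := m) (by linarith)
  have hw := hX.dist_le_max w (x := x) (y := z) (m := m) (by linarith)
  have e : dist y x - dist x m = dist y z - dist m z := by linarith
  rw [e, max_self] at hy
  have t := dist_triangle y m w
  rw [dist_comm m w] at t
  rcases max_cases (dist w x - dist x m) (dist w z - dist m z) with ⟨h, -⟩ | ⟨h, -⟩ <;>
    rw [h] at hw
  · have := le_max_right (dist x y + dist z w) (dist x w + dist y z)
    rw [dist_comm w x] at hw
    linarith
  · have := le_max_left (dist x y + dist z w) (dist x w + dist y z)
    rw [dist_comm w z] at hw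
    linarith [dist_comm x y]

end CAT

/-! ### Gromov products, Busemann functions and the visual metric -/

section GromovHyperbolic

variable {X : Type*} [MetricSpace X]

/-- The Gromov product of two points of a metric space. -/
noncomputable def gprod (o a b : X) : ℝ := (dist a o + dist b o - dist a b) / 2

variable (X) in
/-- Gromov's four point condition. -/
def GromovHyperbolic (δ : ℝ) : Prop :=
  ∀ o a b c : X, min (gprod o a b) (gprod o b c) - δ ≤ gprod o a c

theorem gprod_comm (o a b : X) : gprod o a b = gprod o b a := by
  unfold gprod; rw [dist_comm a b]; ring

theorem gprod_nonneg (o a b : X) : 0 ≤ gprod o a b := by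
  unfold gprod; linarith [dist_triangle a o b, dist_comm o b]

theorem gprod_le_dist (o a b : X) : gprod o a b ≤ dist a o := by
  unfold gprod; linarith [dist_triangle b a o, dist_comm a b]

theorem gprod_base (o o' a b : X) : gprod o a b - dist o o' ≤ gprod o' a b := by
  unfold gprod
  linarith [dist_triangle a o' o, dist_triangle b o' o, dist_comm o o']

theorem gprod_right (o a b b' : X) : gprod o a b - dist b b' ≤ gprod o a b' := by
  unfold gprod
  linarith [dist_triangle b b' o, dist_triangle a b b']

theorem gprod_isometry (g : X ≃ᵢ X) (o a b : X) : gprod (g o) (g a) (g b) = gprod o a b := by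
  simp only [gprod, g.isometry.dist_eq]

theorem IsCATNegOne.gromovHyperbolic (hX : IsCATNegOne X) :
    GromovHyperbolic X (2 * Real.log 2) := by
  intro o a b c
  have h := hX.four_point a b c o
  unfold gprod
  rcases max_cases (dist a b + dist c o) (dist a o + dist b c) with ⟨h1, -⟩ | ⟨h1, -⟩ <;>
    rw [h1] at h
  · have := min_le_left ((dist a o + dist b o - dist a b) / 2) ((dist b o + dist c o - dist b c) / 2)
    linarith
  · have := min_le_right ((dist a o + dist b o - dist a b) / 2) ((dist b o + dist c o - dist b c) / 2)
    linarith

namespace GromovHyperbolic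

variable {δ : ℝ}

theorem nonneg (hδ : GromovHyperbolic X δ) (o : X) : 0 ≤ δ := by
  have := hδ o o o o
  simp [gprod] at this
  exact this

theorem le_gprod (hδ : GromovHyperbolic X δ) {o a b c : X} {r : ℝ} (h1 : r ≤ gprod o a b)
    (h2 : r ≤ gprod o b c) : r - δ ≤ gprod o a c :=
  (sub_le_sub_right (le_min h1 h2) _).trans (hδ o a b c)

/-- Two points at height about `s` above `o`, both almost on the way to `w`, have mutual product at
least `s - K - δ`, while their heights add up to at most `2s + 2K`. -/
theorem dist_le (hδ : GromovHyperbolic X δ) {o u v w : X} {s K : ℝ}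
    (hu : s - K ≤ gprod o u w) (hv : s - K ≤ gprod o v w) (hu' : dist u o ≤ s + K)
    (hv' : dist v o ≤ s + K) : dist u v ≤ 4 * K + 2 * δ := by
  rw [gprod_comm o v w] at hv
  have := hδ.le_gprod hu hv
  unfold gprod at this
  linarith

end GromovHyperbolic

namespace GeodesicRay

theorem dist_eq (c : GeodesicRay X) (s t : ℝ≥0) : dist (c.1 s) (c.1 t) = |(s : ℝ) - t| := by
  rw [c.2.dist_eq, NNReal.dist_eq]

theorem dist_zero (c : GeodesicRay X) (t : ℝ≥0) : dist (c.1 t) (c.1 0) = t := by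
  rw [dist_eq]; simp

theorem dist_le (c : GeodesicRay X) (o : X) (t : ℝ≥0) :
    dist (c.1 t) o ≤ t + dist (c.1 0) o := by
  linarith [dist_triangle (c.1 t) (c.1 0) o, c.dist_zero t]

theorem le_dist (c : GeodesicRay X) (o : X) (t : ℝ≥0) :
    t - dist (c.1 0) o ≤ dist (c.1 t) o := by
  linarith [dist_triangle (c.1 t) o (c.1 0), c.dist_zero t, dist_comm o (c.1 0)]

theorem le_gprod_self (c : GeodesicRay X) (o : X) {s t : ℝ≥0} (h : s ≤ t) :
    s - dist (c.1 0) o ≤ gprod o (c.1 s) (c.1 t) := by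
  refine le_trans ?_ (gprod_base (c.1 0) o _ _)
  have h' : (s : ℝ) ≤ t := h
  unfold gprod
  rw [c.dist_zero, c.dist_zero, c.dist_eq, abs_sub_comm, abs_of_nonneg (by linarith)]
  linarith

theorem endpoint_eq_iff {c c' : GeodesicRay X} :
    c.endpoint = c'.endpoint ↔ ∃ C : ℝ, ∀ t, dist (c.1 t) (c'.1 t) ≤ C :=
  ⟨fun h => Quotient.exact (s := asymptoticSetoid X) h,
    fun h => Quotient.sound (s := asymptoticSetoid X) h⟩

theorem exists_endpoint_eq (ξ : GromovBoundary X) : ∃ c : GeodesicRay X, c.endpoint = ξ :=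
  ⟨Quotient.out (s := asymptoticSetoid X) ξ, Quotient.out_eq (s := asymptoticSetoid X) ξ⟩

theorem endpoint_map (g : X ≃ᵢ X) (c : GeodesicRay X) : (c.map g).endpoint = g • c.endpoint := rfl

theorem le_gprod_of_endpoint_eq {c c' : GeodesicRay X} (h : c.endpoint = c'.endpoint) (o : X) :
    ∃ K : ℝ, ∀ s t t' : ℝ≥0, s ≤ t → s ≤ t' → s - K ≤ gprod o (c.1 t) (c'.1 t') := by
  obtain ⟨C, hC⟩ := endpoint_eq_iff.1 h
  refine ⟨dist (c.1 0) o + dist (c'.1 0) o + C, fun s t t' h1 h2 => ?_⟩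
  have h1' : (s : ℝ) ≤ t := h1
  have h2' : (s : ℝ) ≤ t' := h2
  have e1 := c.le_dist o t
  have e2 := c'.le_dist o t'
  have e3 := dist_triangle (c.1 t) (c'.1 t) (c'.1 t')
  have e4 := hC t
  have e5 := c'.dist_eq t t'
  have e6 := dist_nonneg (x := c.1 0) (y := o)
  have e7 := dist_nonneg (x := c'.1 0) (y := o)
  have e8 := dist_nonneg (x := c.1 t) (y := c'.1 t)
  unfold gprod
  rcases abs_cases ((t : ℝ) - t') with ⟨h, -⟩ | ⟨h, -⟩ <;> rw [h] at e5 <;> linarith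

/-- If the products were unbounded, then for each `s` some pair `c t`, `c' t'` would have product
above `s + K`. Both `c s` and `c' s` are then on the way to `c' t'` up to a bounded error, so they
are uniformly close and the rays are asymptotic. -/
theorem exists_gprod_le {δ : ℝ} (hδ : GromovHyperbolic X δ) {c c' : GeodesicRay X}
    (h : c.endpoint ≠ c'.endpoint) (o : X) :
    ∃ M : ℝ, ∀ t t', gprod o (c.1 t) (c'.1 t') ≤ M := by
  by_contra hcon
  push Not at hcon
  apply h
  have hδ0 := hδ.nonneg o
  set K := dist (c.1 0) o + dist (c'.1 0) o with hK
  have e6 := dist_nonneg (x := c.1 0) (y := o)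
  have e7 := dist_nonneg (x := c'.1 0) (y := o)
  refine endpoint_eq_iff.2 ⟨4 * (K + δ) + 2 * δ, fun s => ?_⟩
  obtain ⟨t, t', htt⟩ := hcon (s + K)
  have ht : s ≤ t := by
    have := gprod_le_dist o (c.1 t) (c'.1 t')
    have h2 := c.dist_le o t
    rw [← NNReal.coe_le_coe]
    linarith
  have ht' : s ≤ t' := by
    have := gprod_le_dist o (c'.1 t') (c.1 t)
    rw [gprod_comm] at this
    have h2 := c'.dist_le o t'
    rw [← NNReal.coe_le_coe]
    linarith
  have g1 := c.le_gprod_self o ht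
  have g2 := c'.le_gprod_self o ht'
  have g3 := hδ.le_gprod (r := s - K) (a := c.1 s) (b := c.1 t) (c := c'.1 t') (o := o)
    (by linarith) (by linarith)
  exact hδ.dist_le (o := o) (w := c'.1 t') (s := s) (by linarith) (by linarith)
    (by linarith [c.dist_le o s]) (by linarith [c'.dist_le o s])

/-- Far out, asymptotic rays have mutual product above the bound `M` for the given pair, so
replacing each of the two rays costs one `δ`. Only the threshold `T` depends on the rays, not the
error. -/
theorem gprod_le_gprod_add {δ : ℝ} (hδ : GromovHyperbolic X δ) {c₁ c₁' c₂ c₂' : GeodesicRay X}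
    (hne : c₁.endpoint ≠ c₁'.endpoint) (h : c₁.endpoint = c₂.endpoint)
    (h' : c₁'.endpoint = c₂'.endpoint) (o : X) :
    ∃ T : ℝ≥0, ∀ t t' s s', T ≤ t → T ≤ t' → T ≤ s → T ≤ s' →
      gprod o (c₁.1 t) (c₁'.1 t') ≤ gprod o (c₂.1 s) (c₂'.1 s') + 2 * δ := by
  obtain ⟨M, hM⟩ := exists_gprod_le hδ hne o
  obtain ⟨K, hK⟩ := le_gprod_of_endpoint_eq h o
  obtain ⟨K', hK'⟩ := le_gprod_of_endpoint_eq h' o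
  refine ⟨(M + max K K').toNNReal, fun t t' s s' ht ht' hs hs' => ?_⟩
  have hδ0 := hδ.nonneg o
  have a1 := Real.le_coe_toNNReal (M + max K K')
  have a2 := hM t t'
  have a3 := hK _ t s ht hs
  have a4 := hK' _ t' s' ht' hs'
  have a5 := le_max_left K K'
  have a6 := le_max_right K K'
  rw [gprod_comm] at a3
  have b1 := hδ.le_gprod (r := gprod o (c₁.1 t) (c₁'.1 t')) (a := c₂.1 s) (b := c₁.1 t)
    (c := c₁'.1 t') (o := o) (by linarith) le_rfl
  have b2 := hδ.le_gprod (r := gprod o (c₁.1 t) (c₁'.1 t') - δ) (a := c₂.1 s) (b := c₁'.1 t')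
    (c := c₂'.1 s') (o := o) (by linarith) (by linarith)
  linarith

theorem tendsto_busemann (c : GeodesicRay X) (x y : X) :
    ∃ l, Tendsto (fun t : ℝ≥0 => dist (c.1 t) x - dist (c.1 t) y) atTop (𝓝 l) := by
  have key : ∀ x, ∃ l, Tendsto (fun t : ℝ≥0 => dist (c.1 t) x - t) atTop (𝓝 l) := by
    intro x
    -- `d(c t, x) - t` is nonincreasing and bounded below, by the triangle inequality.
    refine ⟨_, tendsto_atTop_ciInf ?_ ?_⟩
    · intro s t hst
      have hst' : (s : ℝ) ≤ t := hst
      have := dist_triangle (c.1 t) (c.1 s) x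
      rw [c.dist_eq, abs_of_nonneg (by linarith)] at this
      simp only
      linarith
    · refine ⟨-dist (c.1 0) x, ?_⟩
      rintro _ ⟨t, rfl⟩
      have := c.le_dist x t
      simp only
      linarith
  obtain ⟨l, hl⟩ := key x
  obtain ⟨l', hl'⟩ := key y
  refine ⟨l - l', (hl.sub hl').congr fun t => by ring⟩

/-- `busemann` is computed along a chosen representative. Another ray to the same point gives almost
the same value, because `d(a, x) - d(a, y)` is a constant minus twice `(a | x)_y`, and products with
`x` based at `y` agree up to `δ` for far points of asymptotic rays. -/
theorem abs_busemann_sub_le {δ : ℝ} (hδ : GromovHyperbolic X δ) (c : GeodesicRay X) (x y : X) :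
    ∃ T : ℝ≥0, ∀ t, T ≤ t →
      |busemann c.endpoint x y - (dist (c.1 t) x - dist (c.1 t) y)| ≤ 2 * δ := by
  set b : GeodesicRay X := Quotient.out (s := asymptoticSetoid X) c.endpoint with hb
  have hbc : b.endpoint = c.endpoint := Quotient.out_eq (s := asymptoticSetoid X) c.endpoint
  obtain ⟨l, hl⟩ := b.tendsto_busemann x y
  have hbl : busemann c.endpoint x y = l := hl.limUnder_eq
  obtain ⟨K, hK⟩ := le_gprod_of_endpoint_eq hbc y
  refine ⟨(dist x y + K).toNNReal, fun t ht => ?_⟩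
  rw [hbl]
  have hlim := ((hl.sub_const (dist (c.1 t) x - dist (c.1 t) y))).abs
  refine le_of_tendsto hlim ?_
  filter_upwards [eventually_ge_atTop (dist x y + K).toNNReal] with s hs
  have a1 := Real.le_coe_toNNReal (dist x y + K)
  have a2 := hK _ s t hs ht
  have a3 := gprod_le_dist y x (b.1 s)
  have a4 := gprod_le_dist y x (c.1 t)
  rw [gprod_comm] at a3 a4
  have b1 := hδ.le_gprod (r := gprod y (c.1 t) x) (a := b.1 s) (b := c.1 t) (c := x) (o := y)
    (by linarith) le_rfl
  have b2 := hδ.le_gprod (r := gprod y (b.1 s) x) (a := c.1 t) (b := b.1 s) (c := x) (o := y)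
    (by rw [gprod_comm y (c.1 t)]; linarith) le_rfl
  unfold gprod at b1 b2
  rw [abs_le]
  constructor <;> linarith

end GeodesicRay

/-- Bourdon's Gromov product on the boundary agrees with the Gromov product of points close to
the boundary, up to an additive error depending only on the hyperbolicity constant. -/
theorem GromovHyperbolic.abs_gromovProduct_sub_gprod_le {δ : ℝ} (hδ : GromovHyperbolic X δ)
    {c c' : GeodesicRay X} (hne : c.endpoint ≠ c'.endpoint)
    (hline : ∃ z, LiesOnGeodesic c.endpoint c'.endpoint z) (x : X) :
    ∃ T : ℝ≥0, ∀ t, T ≤ t →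
      |gromovProduct x c.endpoint c'.endpoint - gprod x (c.1 t) (c'.1 t)| ≤ 4 * δ := by
  unfold gromovProduct
  have hz := @Classical.epsilon_spec_aux X ⟨x⟩ (LiesOnGeodesic c.endpoint c'.endpoint) hline
  set z := @Classical.epsilon X ⟨x⟩ (LiesOnGeodesic c.endpoint c'.endpoint)
  obtain ⟨γ, hγ, h1, h2, r, hr⟩ := hz
  obtain ⟨T₁, hT₁⟩ := (backwardRay γ hγ).abs_busemann_sub_le hδ x z
  obtain ⟨T₂, hT₂⟩ := (forwardRay γ hγ).abs_busemann_sub_le hδ x z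
  rw [h1] at hT₁
  rw [h2] at hT₂
  obtain ⟨T₃, hT₃⟩ := GeodesicRay.gprod_le_gprod_add hδ hne h1.symm h2.symm x
  obtain ⟨T₄, hT₄⟩ := GeodesicRay.gprod_le_gprod_add hδ (by rwa [h1, h2]) h1 h2 x
  refine ⟨max T₃ T₄, fun t ht => ?_⟩
  have ht3 := (le_max_left _ _).trans ht
  have ht4 := (le_max_right _ _).trans ht
  set s : ℝ≥0 := max (max T₁ T₂) (max (max T₃ T₄) ‖r‖₊) with hs
  have s1 : T₁ ≤ s := by simp [hs]
  have s2 : T₂ ≤ s := by simp [hs]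
  have s3 : T₃ ≤ s := by simp [hs]
  have s4 : T₄ ≤ s := by simp [hs]
  have s5 : |r| ≤ s := by
    have : ‖r‖₊ ≤ s := by simp [hs]
    have h : ((‖r‖₊ : ℝ≥0) : ℝ) ≤ s := this
    simpa using h
  have e1 := hT₁ s s1
  have e2 := hT₂ s s2
  have e3 := hT₃ t t s s ht3 ht3 s3 s3
  have e4 := hT₄ s s t t s4 s4 ht4 ht4
  -- The distances from `γ (-s)` and `γ s` to `z = γ r` add up to `d(γ (-s), γ s) = 2s`. So the mean
  -- of the two Busemann values is the Gromov product of these points up to `2δ`; exchanging rays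
  -- costs another `2δ`.
  have d1 : dist ((backwardRay γ hγ).1 s) z = r + s := by
    rw [← hr]
    show dist (γ _) (γ _) = _
    rw [hγ.dist_eq, Real.dist_eq, abs_sub_comm, abs_of_nonneg] <;> linarith [neg_abs_le r]
  have d2 : dist ((forwardRay γ hγ).1 s) z = s - r := by
    rw [← hr]
    show dist (γ _) (γ _) = _
    rw [hγ.dist_eq, Real.dist_eq, abs_of_nonneg]; linarith [le_abs_self r]
  have d3 : dist ((backwardRay γ hγ).1 s) ((forwardRay γ hγ).1 s) = 2 * s := by
    show dist (γ _) (γ _) = _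
    rw [hγ.dist_eq, Real.dist_eq, abs_sub_comm, abs_of_nonneg]
    · ring
    · linarith [s.coe_nonneg]
  rw [d1] at e1
  rw [d2] at e2
  have d4 : gprod x ((backwardRay γ hγ).1 s) ((forwardRay γ hγ).1 s) =
    (dist ((backwardRay γ hγ).1 s) x + dist ((forwardRay γ hγ).1 s) x - 2 * s) / 2 := by
    unfold gprod; rw [d3]
  rw [d4] at e3 e4
  rw [abs_le] at e1 e2 ⊢
  constructor <;> linarith [e1.1, e1.2, e2.1, e2.2]

/-- The Gromov product of consecutive points of the orbit of a boundary point grows like the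
displacement. -/
theorem GromovHyperbolic.abs_gromovProduct_pow_sub_dist_le {δ : ℝ} (hδ : GromovHyperbolic X δ)
    (hline : ∀ ξ ξ' : GromovBoundary X, ξ ≠ ξ' → ∃ z, LiesOnGeodesic ξ ξ' z)
    (o : X) (p : X ≃ᵢ X) {ξ : GromovBoundary X} (hξ : p • ξ ≠ ξ) :
    ∃ K : ℝ, ∀ k : ℕ,
      |gromovProduct o (p ^ k • ξ) (p ^ (k + 1) • ξ) - dist o ((p ^ k) o)| ≤ K := by
  obtain ⟨c, rfl⟩ := GeodesicRay.exists_endpoint_eq ξ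
  obtain ⟨M, hM⟩ := GeodesicRay.exists_gprod_le hδ (c := c) (c' := c.map p)
    (by rw [GeodesicRay.endpoint_map]; exact hξ.symm) o
  set D := dist o (p o) with hD
  have hD0 : 0 ≤ D := dist_nonneg
  have hδ0 := hδ.nonneg o
  have hM0 : 0 ≤ M := (gprod_nonneg _ _ _).trans (hM 0 0)
  refine ⟨4 * δ + (M + 2 * (M + 4 * D + δ)), fun k => ?_⟩
  have hne : p ^ k • c.endpoint ≠ p ^ (k + 1) • c.endpoint := by
    rw [pow_succ, mul_smul]
    exact fun h => hξ (smul_left_cancel _ h).symm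
  obtain ⟨T, hT⟩ := hδ.abs_gromovProduct_sub_gprod_le (c := c.map (p ^ k))
    (c' := c.map (p ^ (k + 1))) hne (hline _ _ hne) o
  have hT' := hT T le_rfl
  rw [GeodesicRay.endpoint_map, GeodesicRay.endpoint_map] at hT'
  set x := (p ^ k).symm o with hx
  have hox : (p ^ k) x = o := (p ^ k).apply_symm_apply o
  have hcomm : ∀ y, (p ^ (k + 1)) y = (p ^ k) (p y) := by intro y; rw [pow_succ]; rfl
  have hcomm' : ∀ y, (p ^ (k + 1)) y = p ((p ^ k) y) := by intro y; rw [pow_succ']; rfl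
  -- Equivariance moves the power of `p` from the boundary points to the base point.
  have g1 : gprod o ((c.map (p ^ k)).1 T) ((c.map (p ^ (k + 1))).1 T) =
      gprod x (c.1 T) (p (c.1 T)) := by
    show gprod o ((p ^ k) (c.1 T)) ((p ^ (k + 1)) (c.1 T)) = _
    rw [hcomm]
    conv_lhs => rw [← hox]
    exact gprod_isometry _ _ _ _
  have hdx : dist o ((p ^ k) o) = dist x o := by
    conv_lhs => rw [← hox, (p ^ k).isometry.dist_eq]
    rw [hox]
  have hpx : dist x (p x) = D := by
    rw [← (p ^ k).isometry.dist_eq, ← hcomm, hcomm', hox]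
  set a := c.1 T
  have m0 : gprod o a (p a) ≤ M := hM T T
  -- As powers of `p` commute, `p` moves `x` by `D`; it also moves `o` by `D`. Hence `(a | x)_o` and
  -- `(p a | x)_o` differ by at most `2D`. If they were large, hyperbolicity would make `(a | p
  -- a)_o` exceed `M`.
  have m1 : gprod o a x ≤ gprod o (p a) x + 2 * D := by
    have u1 := gprod_isometry p o a x
    have u2 := gprod_base (p o) o (p a) (p x)
    have u3 := gprod_right o (p a) (p x) x
    rw [dist_comm] at u2 u3
    linarith
  have m2 : gprod o (p a) x ≤ gprod o a x + 2 * D := by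
    have u1 := gprod_isometry p o a x
    have u2 := gprod_base o (p o) (p a) (p x)
    have u3 := gprod_right o (p a) x (p x)
    linarith
  have m3 := hδ.le_gprod (r := gprod o a x - 2 * D) (o := o) (a := a) (b := x) (c := p a)
    (by linarith) (by rw [gprod_comm o x]; linarith)
  have m4 : gprod x a (p a) = dist x o + gprod o a (p a) - gprod o a x - gprod o (p a) x := by
    unfold gprod; ring
  have n1 := gprod_nonneg o a x
  have n2 := gprod_nonneg o (p a) x
  have n3 := gprod_nonneg o a (p a)
  rw [g1, m4] at hT'
  rw [hdx]
  rw [abs_le] at hT' ⊢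
  constructor <;> linarith [hT'.1, hT'.2]

end GromovHyperbolic

/-! ### Properness, compactness and circumcenters -/

section Proper

variable {X : Type*} [MetricSpace X]

/-- Hopf-Rinow: a complete locally compact geodesic space is proper. -/
theorem IsCATNegOne.properSpace [CompleteSpace X] [LocallyCompactSpace X] (hX : IsCATNegOne X) :
    ProperSpace X := by
  refine ⟨fun o b => ?_⟩
  rcases lt_or_ge b 0 with hb | hb
  · rw [Metric.closedBall_eq_empty.2 hb]; exact isCompact_empty
  set S : Set ℝ := {r | IsCompact (Metric.closedBall o r)} with hS
  have hmono : ∀ {r s : ℝ}, s ∈ S → r ≤ s → r ∈ S := fun hs h =>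
    IsCompact.of_isClosed_subset hs Metric.isClosed_closedBall (Metric.closedBall_subset_closedBall h)
  have h0 : (0 : ℝ) ∈ S := by
    show IsCompact (Metric.closedBall o 0)
    rw [Metric.closedBall_zero]; exact isCompact_singleton
  -- Continuous induction on the radius. At a limit radius, the ball lies close to a smaller compact
  -- ball along geodesics, hence is totally bounded; past a good radius, local compactness supplies
  -- a compact thickening that contains a larger ball.
  have hsub : Set.Icc 0 b ⊆ S := by
    refine IsClosed.Icc_subset_of_forall_mem_nhdsWithin ?_ h0 ?_
    · refine isClosed_of_closure_subset fun R hR => ?_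
      have hRI : R ∈ Set.Icc 0 b :=
        closure_minimal Set.inter_subset_right isClosed_Icc hR
      refine ⟨?_, hRI⟩
      have hlt : ∀ r < R, r ∈ S := by
        intro r hr
        obtain ⟨s, hs, hs'⟩ := mem_closure_iff_nhds.1 hR _ (Ioi_mem_nhds hr)
        exact hmono hs'.1 (le_of_lt hs)
      rcases hRI.1.eq_or_lt with h | hRpos
      · rw [← h]; exact h0
      refine isCompact_iff_totallyBounded_isComplete.2 ⟨?_, Metric.isClosed_closedBall.isComplete⟩
      refine Metric.totallyBounded_iff.2 fun ε hε => ?_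
      set r := max 0 (R - ε / 3) with hr
      have hrR : r < R := max_lt hRpos (by linarith)
      obtain ⟨t, ht, htc⟩ := Metric.totallyBounded_iff.1 (hlt r hrR).totallyBounded (ε / 2) (by linarith)
      refine ⟨t, ht, fun x hx => ?_⟩
      have hx' : dist o x ≤ R := by rw [dist_comm]; exact hx
      have hm : ∃ m, dist o m ≤ r ∧ dist m x ≤ ε / 3 := by
        rcases le_total (dist o x) r with h | h
        · exact ⟨x, h, by rw [dist_self]; linarith⟩
        · obtain ⟨m, h1, h2⟩ := hX.exists_between o x (a := r) (le_max_left _ _) h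
          refine ⟨m, h1.le, ?_⟩
          linarith [le_max_right 0 (R - ε / 3)]
      obtain ⟨m, hm1, hm2⟩ := hm
      have := htc (show m ∈ Metric.closedBall o r by rw [Metric.mem_closedBall, dist_comm]; exact hm1)
      simp only [Set.mem_iUnion, Metric.mem_ball, exists_prop] at this ⊢
      obtain ⟨y, hy, hy'⟩ := this
      exact ⟨y, hy, by linarith [dist_triangle x m y, dist_comm x m]⟩
    · rintro R ⟨hR, hRI⟩
      obtain ⟨δ, hδ, hc⟩ := IsCompact.exists_isCompact_cthickening (s := Metric.closedBall o R) hR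
      have : R + δ ∈ S := by
        refine IsCompact.of_isClosed_subset hc Metric.isClosed_closedBall fun x hx => ?_
        have hx' : dist o x ≤ R + δ := by rw [dist_comm]; exact hx
        rcases le_total (dist o x) R with h | h
        · exact Metric.self_subset_cthickening _ (by rw [Metric.mem_closedBall, dist_comm]; exact h)
        · obtain ⟨m, h1, h2⟩ := hX.exists_between o x (a := R) hRI.1 h
          refine Metric.mem_cthickening_of_dist_le x m δ _
            (by rw [Metric.mem_closedBall, dist_comm]; exact h1.le) ?_
          rw [dist_comm]; linarith
      exact mem_nhdsWithin_of_mem_nhds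
        (mem_of_superset (Iio_mem_nhds (show R < R + δ by linarith)) fun r hr => hmono this (le_of_lt hr))
  exact hsub ⟨hb, le_rfl⟩

/-- Arzelà-Ascoli along an ultrafilter, for maps that are eventually isometric. -/
theorem exists_isometry_tendsto_hyperfilter [ProperSpace X] {T : Type*} [MetricSpace T]
    {Γ : ℕ → T → X} (h : ∀ s t, ∀ᶠ n in atTop, dist (Γ n s) (Γ n t) = dist s t) (t₀ : T) (o : X)
    {M : ℝ} (hM : ∀ᶠ n in atTop, dist (Γ n t₀) o ≤ M) :
    ∃ γ : T → X, Isometry γ ∧ ∀ s, Tendsto (fun n => Γ n s) (hyperfilter ℕ) (𝓝 (γ s)) := by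
  have hle : ((hyperfilter ℕ : Ultrafilter ℕ) : Filter ℕ) ≤ atTop := Nat.hyperfilter_le_atTop
  have hlim : ∀ s, ∃ x, Tendsto (fun n => Γ n s) (hyperfilter ℕ) (𝓝 x) := by
    intro s
    have hb : ∀ᶠ n in ((hyperfilter ℕ : Ultrafilter ℕ) : Filter ℕ),
        Γ n s ∈ Metric.closedBall o (dist s t₀ + M) := by
      filter_upwards [hle (h s t₀), hle hM] with n h1 h2
      rw [Metric.mem_closedBall]
      linarith [dist_triangle (Γ n s) (Γ n t₀) o]
    obtain ⟨x, -, hx⟩ := (isCompact_closedBall o (dist s t₀ + M)).ultrafilter_le_nhds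
      ((hyperfilter ℕ).map fun n => Γ n s) (le_principal_iff.2 hb)
    exact ⟨x, hx⟩
  choose γ hγ using hlim
  refine ⟨γ, Isometry.of_dist_eq fun s t => ?_, hγ⟩
  have h1 := (hγ s).dist (hγ t)
  have h2 : Tendsto (fun n => dist (Γ n s) (Γ n t)) (hyperfilter ℕ) (𝓝 (dist s t)) := by
    refine tendsto_const_nhds.congr' ?_
    filter_upwards [hle (h s t)] with n hn using hn.symm
  exact tendsto_nhds_unique h1 h2

/-- Stewart's inequality seen from `m'` has right side `sinh d(x, y)` by the addition formula, so
`cosh d(m', m) ≤ 1`. -/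
theorem IsCATNegOne.eq_of_dist_eq (hX : IsCATNegOne X) {x y m m' : X}
    (hm : dist x m + dist m y = dist x y) (h1 : dist x m' = dist x m) (h2 : dist m' y = dist m y) :
    m' = m := by
  rcases (dist_nonneg (x := x) (y := y)).eq_or_lt with h0 | h0
  · have e1 := dist_nonneg (x := x) (y := m)
    have e2 := dist_nonneg (x := m) (y := y)
    have e3 : x = m := dist_eq_zero.1 (by linarith)
    have e4 : x = m' := dist_eq_zero.1 (by linarith)
    rw [← e3, ← e4]
  have hS := hX.stewart m' hm
  have hs : 0 < Real.sinh (dist x y) := Real.sinh_pos_iff.2 h0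
  have : Real.cosh (dist m' m) * Real.sinh (dist x y) ≤ 1 * Real.sinh (dist x y) := by
    refine hS.trans (le_of_eq ?_)
    rw [dist_comm m' x, h1, h2, ← hm, Real.sinh_add]; ring
  have := le_of_mul_le_mul_right this hs
  by_contra hne
  have hlt : 0 < dist m' m := dist_pos.2 hne
  linarith [(Real.one_lt_cosh).2 hlt.ne']

theorem IsCATNegOne.map_eq_of_fixed (hX : IsCATNegOne X) (p : X ≃ᵢ X) {x y m : X}
    (hx : p x = x) (hy : p y = y) (hm : dist x m + dist m y = dist x y) : p m = m := by
  refine hX.eq_of_dist_eq hm ?_ ?_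
  · conv_lhs => rw [← hx, p.isometry.dist_eq]
  · conv_lhs => rw [← hy, p.isometry.dist_eq]

/-- A bounded nonempty invariant set has an invariant circumcenter. -/
theorem IsCATNegOne.exists_fixed_circumcenter [ProperSpace X] (hX : IsCATNegOne X) (p : X ≃ᵢ X)
    {S : Set X} (hne : S.Nonempty) (hb : Bornology.IsBounded S)
    (hS : ∀ y ∈ S, p.symm y ∈ S) :
    ∃ m, p m = m ∧ ∀ r, (∀ y ∈ S, ∀ y' ∈ S, dist y y' ≤ r) → ∀ y ∈ S, dist m y ≤ r := by
  obtain ⟨y₀, hy₀⟩ := hne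
  have : Nonempty S := ⟨⟨y₀, hy₀⟩⟩
  -- Stewart's inequality is linear in the cosh of distances, so the supremum of these plays the
  -- role of the squared circumradius.
  set Q : X → ℝ := fun w => ⨆ y : S, Real.cosh (dist w y) with hQ
  have hbdd : ∀ w : X, BddAbove (Set.range fun y : S => Real.cosh (dist w y)) := by
    intro w
    obtain ⟨C, hC⟩ := hb.subset_closedBall w
    refine ⟨Real.cosh C, ?_⟩
    rintro _ ⟨y, rfl⟩
    have := hC y.2
    rw [Metric.mem_closedBall, dist_comm] at this
    simp only
    rw [Real.cosh_le_cosh, abs_of_nonneg dist_nonneg]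
    exact this.trans (le_abs_self C)
  have hle : ∀ w : X, ∀ y ∈ S, Real.cosh (dist w y) ≤ Q w := fun w y hy =>
    le_ciSup (hbdd w) ⟨y, hy⟩
  have hge : ∀ (w : X) (r : ℝ), (∀ y ∈ S, Real.cosh (dist w y) ≤ r) → Q w ≤ r := fun w r h =>
    ciSup_le fun y => h y y.2
  have hlsc : LowerSemicontinuous Q := by
    refine lowerSemicontinuous_ciSup hbdd fun y => Continuous.lowerSemicontinuous ?_
    exact Real.continuous_cosh.comp (continuous_id.dist continuous_const)
  obtain ⟨R, hR⟩ : ∃ R, 0 ≤ R ∧ Q y₀ ≤ Real.cosh R := by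
    obtain ⟨C, hC⟩ := hb.subset_closedBall y₀
    refine ⟨|C|, abs_nonneg _, hge _ _ fun y hy => ?_⟩
    have := hC hy
    rw [Metric.mem_closedBall, dist_comm] at this
    rw [Real.cosh_le_cosh, abs_of_nonneg dist_nonneg, abs_abs]
    exact this.trans (le_abs_self C)
  obtain ⟨m, -, hm⟩ := (hlsc.lowerSemicontinuousOn _).exists_isMinOn
    (s := Metric.closedBall y₀ R) ⟨y₀, by simpa using hR.1⟩ (isCompact_closedBall _ _)
  have hmin : ∀ w, Q m ≤ Q w := by
    intro w
    by_cases hw : w ∈ Metric.closedBall y₀ R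
    · exact hm hw
    · refine (hm (show y₀ ∈ Metric.closedBall y₀ R by simpa using hR.1)).trans ?_
      refine hR.2.trans (le_trans ?_ (hle w y₀ hy₀))
      rw [Real.cosh_le_cosh, abs_of_nonneg hR.1, abs_of_nonneg dist_nonneg]
      rw [Metric.mem_closedBall, not_le] at hw
      exact hw.le
  refine ⟨m, ?_, fun r hr y hy => ?_⟩
  · have hpm : Q (p m) ≤ Q m := by
      refine hge _ _ fun y hy => ?_
      have : dist (p m) y = dist m (p.symm y) := by
        conv_lhs => rw [← p.apply_symm_apply y, p.isometry.dist_eq]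
      rw [this]
      exact hle _ _ (hS y hy)
    obtain ⟨w, h1, h2⟩ := hX.exists_between m (p m) (a := dist m (p m) / 2)
      (by linarith [dist_nonneg (x := m) (y := p m)]) (by linarith [dist_nonneg (x := m) (y := p m)])
    set a := dist m (p m) / 2 with ha
    have h2' : dist w (p m) = a := by linarith
    have hd : dist m (p m) = a + a := by linarith
    have ha0 : 0 ≤ a := by linarith [dist_nonneg (x := m) (y := p m)]
    -- At the midpoint `w` of `m` and `p m`, Stewart's inequality gains a factor `cosh a`.
    -- Minimality of `m` then forces `a = 0`.
    have hQw : Q w ≤ Q m / Real.cosh a := by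
      refine hge _ _ fun y hy => ?_
      rcases ha0.eq_or_lt with h0 | h0
      · rw [← h0] at h1 ⊢
        rw [← dist_eq_zero.1 h1]
        simpa using hle m y hy
      have hst := hX.stewart y (x := m) (y := p m) (m := w) (by linarith)
      rw [h1, h2', hd, Real.sinh_add, dist_comm y w, dist_comm y m, dist_comm y (p m)] at hst
      have e1 := hle m y hy
      have e2 := (hle (p m) y hy).trans hpm
      have hs : 0 < Real.sinh a := Real.sinh_pos_iff.2 h0
      rw [le_div_iff₀ (Real.cosh_pos a)]
      have e3 : 2 * Real.sinh a * (Real.cosh (dist w y) * Real.cosh a) ≤ 2 * Real.sinh a * Q m := by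
        nlinarith
      exact le_of_mul_le_mul_left e3 (by positivity)
    have hQ0 : 0 < Q m := (Real.cosh_pos _).trans_le (hle m y₀ hy₀)
    have e4 := (hmin w).trans hQw
    rw [le_div_iff₀ (Real.cosh_pos a)] at e4
    have e5 : Real.cosh a ≤ 1 := by nlinarith
    have e6 : a = 0 := by
      by_contra hne
      linarith [Real.one_lt_cosh.2 hne]
    exact (dist_eq_zero.1 (by rw [hd, e6]; simp)).symm
  · have h1 : Q m ≤ Real.cosh r := by
      refine (hmin y₀).trans (hge _ _ fun y' hy' => ?_)
      rw [Real.cosh_le_cosh, abs_of_nonneg dist_nonneg]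
      exact (hr _ hy₀ _ hy').trans (le_abs_self r)
    have h2 := (hle m y hy).trans h1
    rw [Real.cosh_le_cosh, abs_of_nonneg dist_nonneg] at h2
    have h3 : 0 ≤ r := dist_nonneg.trans (hr _ hy₀ _ hy₀)
    rwa [abs_of_nonneg h3] at h2

end Proper

/-! ### Geodesic rays and visibility -/

section Rays

variable {X : Type*} [MetricSpace X]

theorem GromovHyperbolic.dist_ray_le {δ : ℝ} (hδ : GromovHyperbolic X δ) (c : GeodesicRay X)
    {o m u : X} {s n : ℝ≥0} (hsn : s ≤ n) (h1 : dist u m = s)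
    (h2 : dist u (c.1 n) = dist m (c.1 n) - s) :
    dist u (c.1 s) ≤ 4 * (dist m o + dist (c.1 0) o) + 2 * δ := by
  have e0 := dist_nonneg (x := m) (y := o)
  have e1 := dist_nonneg (x := c.1 0) (y := o)
  have g1 : gprod m u (c.1 n) = s := by
    unfold gprod; rw [h1, h2, dist_comm m]; ring
  have g2 := gprod_base m o u (c.1 n)
  have g3 := c.le_gprod_self o hsn
  exact hδ.dist_le (o := o) (w := c.1 n) (s := s) (by linarith) (by linarith)
    (by linarith [dist_triangle u m o]) (by linarith [c.dist_le o s])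

/-- Geodesic segments from a fixed point to points going to infinity subconverge to a ray. -/
theorem IsCATNegOne.exists_limit_ray [ProperSpace X] (hX : IsCATNegOne X) (x : X) {y : ℕ → X}
    (hy : Tendsto (fun n => dist x (y n)) atTop atTop) :
    ∃ (c : GeodesicRay X) (g : ℕ → ℝ≥0 → X), c.1 0 = x ∧ ∀ s,
      (∀ᶠ n in atTop, dist x (g n s) = s ∧ dist (g n s) (y n) = dist x (y n) - s) ∧
      Tendsto (fun n => g n s) (hyperfilter ℕ) (𝓝 (c.1 s)) := by
  choose γ h0 h1 h using fun n => hX.exists_geodesic x (y n)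
  have hd : ∀ s : ℝ≥0, ∀ᶠ n in atTop, (s : ℝ) ∈ Set.Icc 0 (dist x (y n)) := fun s => by
    filter_upwards [hy.eventually_ge_atTop (s : ℝ)] with n hn using ⟨s.2, hn⟩
  obtain ⟨c, hc, hlim⟩ := exists_isometry_tendsto_hyperfilter (Γ := fun n (s : ℝ≥0) => γ n s)
    (fun s t => by
      filter_upwards [hd s, hd t] with n hs ht
      rw [h n _ hs _ ht, NNReal.dist_eq]) 0 x (M := 0) (by simp [h0])
  refine ⟨⟨c, hc⟩, fun n s => γ n s, ?_, fun s => ⟨?_, hlim s⟩⟩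
  · refine tendsto_nhds_unique (hlim 0) ?_
    simp [h0]
  · filter_upwards [hd s] with n hs
    have hD : (0 : ℝ) ≤ dist x (y n) := dist_nonneg
    constructor
    · conv_lhs => rw [← h0 n]
      rw [h n 0 ⟨le_rfl, hD⟩ s hs]; simp
    · conv_lhs => rw [← h1 n]
      rw [h n s hs _ ⟨hD, le_rfl⟩, abs_sub_comm, abs_of_nonneg (by linarith [hs.2])]

/-- The segments from `x` to the points of a ray to `ξ` subconverge, and
`GromovHyperbolic.dist_ray_le` keeps them at bounded distance from that ray, uniformly in `n`. -/
theorem IsCATNegOne.exists_ray [ProperSpace X] (hX : IsCATNegOne X) (x : X)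
    (ξ : GromovBoundary X) : ∃ c : GeodesicRay X, c.1 0 = x ∧ c.endpoint = ξ := by
  obtain ⟨b, rfl⟩ := GeodesicRay.exists_endpoint_eq ξ
  have hlim : Tendsto (fun n : ℕ => dist x (b.1 n)) atTop atTop := by
    refine tendsto_atTop_mono (f := fun n : ℕ => (n : ℝ) - dist (b.1 0) x) (fun n => ?_)
      (tendsto_atTop_add_const_right _ _ tendsto_natCast_atTop_atTop)
    have := b.le_dist x n
    rw [dist_comm x]
    simpa using this
  obtain ⟨c, g, hc, hg⟩ := hX.exists_limit_ray x hlim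
  refine ⟨c, hc, GeodesicRay.endpoint_eq_iff.2
    ⟨4 * (dist x x + dist (b.1 0) x) + 2 * (2 * Real.log 2), fun s => ?_⟩⟩
  · refine le_of_tendsto ((hg s).2.dist tendsto_const_nhds) ?_
    filter_upwards [Nat.hyperfilter_le_atTop (hg s).1,
      Nat.hyperfilter_le_atTop (eventually_ge_atTop ⌈s⌉₊)] with n h1 h2
    exact hX.gromovHyperbolic.dist_ray_le b (o := x) (m := x) (n := (n : ℝ≥0))
      (Nat.ceil_le.1 h2) (by rw [dist_comm]; exact h1.1) h1.2

/-- For rays at angle `θ` in the hyperbolic plane, `cosh d - 1 = sinh² t (1 - cos θ)`; here the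
corresponding quotient is nondecreasing in `t`. Stewart's inequality is used twice: for `c t` on `[c
0, c T]` seen from `c' t`, and for `c' t` on `[c' 0, c' T]` seen from `c T`. -/
theorem IsCATNegOne.cosh_dist_ray_le (hX : IsCATNegOne X) {c c' : GeodesicRay X}
    (h0 : c.1 0 = c'.1 0) {t T : ℝ≥0} (htT : t ≤ T) :
    (Real.cosh (dist (c.1 t) (c'.1 t)) - 1) * Real.sinh T ^ 2 ≤
      Real.sinh t ^ 2 * (Real.cosh (dist (c.1 T) (c'.1 T)) - 1) := by
  have htT' : (t : ℝ) ≤ T := htT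
  have ht0 : (0 : ℝ) ≤ t := t.2
  have d : ∀ b : GeodesicRay X, dist (b.1 0) (b.1 t) = t ∧ dist (b.1 t) (b.1 T) = T - t ∧
      dist (b.1 0) (b.1 T) = T := fun b => ⟨by rw [dist_comm, b.dist_zero],
    by rw [b.dist_eq, abs_sub_comm, abs_of_nonneg (by linarith)], by rw [dist_comm, b.dist_zero]⟩
  obtain ⟨a1, a2, a3⟩ := d c
  obtain ⟨b1, b2, b3⟩ := d c'
  have S1 := hX.stewart (c'.1 t) (x := c.1 0) (y := c.1 T) (m := c.1 t) (by linarith)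
  have S2 := hX.stewart (c.1 T) (x := c'.1 0) (y := c'.1 T) (m := c'.1 t) (by linarith)
  rw [a1, a2, a3, h0, dist_comm (c'.1 t) (c'.1 0), b1, dist_comm (c'.1 t) (c.1 t)] at S1
  rw [b1, b2, b3, ← h0, dist_comm (c.1 T) (c.1 0), a3] at S2
  rw [dist_comm (c'.1 t) (c.1 T)] at S1
  set P := Real.cosh (dist (c.1 t) (c'.1 t))
  set Q := Real.cosh (dist (c.1 T) (c'.1 T))
  set R := Real.cosh (dist (c.1 T) (c'.1 t))
  have hsT : 0 ≤ Real.sinh T := Real.sinh_nonneg_iff.2 (by linarith)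
  have hst : 0 ≤ Real.sinh t := Real.sinh_nonneg_iff.2 ht0
  have m1 := mul_le_mul_of_nonneg_right S1 hsT
  have m2 := mul_le_mul_of_nonneg_left S2 hst
  have key : Real.sinh (T - t) * Real.cosh t * Real.sinh T +
      Real.sinh t * (Real.sinh (T - t) * Real.cosh T) = Real.sinh T ^ 2 - Real.sinh t ^ 2 := by
    rw [Real.sinh_sub]
    have e1 := Real.cosh_sq (t : ℝ)
    have e2 := Real.cosh_sq (T : ℝ)
    linear_combination Real.sinh T ^ 2 * e1 - Real.sinh t ^ 2 * e2
  nlinarith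

/-- By `cosh_dist_ray_le`, rays that separate at all do so at the rate of `sinh² T`, so they cannot
be asymptotic. -/
theorem IsCATNegOne.ray_eq (hX : IsCATNegOne X) {c c' : GeodesicRay X}
    (h0 : c.1 0 = c'.1 0) (h : c.endpoint = c'.endpoint) : c = c' := by
  obtain ⟨C, hC⟩ := GeodesicRay.endpoint_eq_iff.1 h
  refine Subtype.ext (funext fun t => ?_)
  by_contra hne
  have hpos : 0 < Real.cosh (dist (c.1 t) (c'.1 t)) - 1 :=
    sub_pos.2 (Real.one_lt_cosh.2 (dist_pos.2 hne).ne')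
  set ε := Real.cosh (dist (c.1 t) (c'.1 t)) - 1 with hε
  set B := Real.sinh t ^ 2 * (Real.cosh C - 1) with hB
  have hlim : Tendsto (fun T : ℝ≥0 => ε * Real.sinh T ^ 2) atTop atTop := by
    refine Tendsto.const_mul_atTop hpos ?_
    refine (tendsto_pow_atTop two_ne_zero).comp ?_
    refine tendsto_atTop_mono (f := fun T : ℝ≥0 => (T : ℝ)) (fun T => ?_)
      (NNReal.tendsto_coe_atTop.2 tendsto_id)
    exact Real.self_le_sinh_iff.2 T.2
  obtain ⟨T, h1, h2⟩ := ((hlim.eventually_gt_atTop B).and (eventually_ge_atTop t)).exists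
  have h3 := hX.cosh_dist_ray_le h0 h2
  have h4 : Real.cosh (dist (c.1 T) (c'.1 T)) ≤ Real.cosh C := by
    rw [Real.cosh_le_cosh, abs_of_nonneg dist_nonneg]
    exact (hC T).trans (le_abs_self C)
  have h5 : Real.sinh t ^ 2 * (Real.cosh (dist (c.1 T) (c'.1 T)) - 1) ≤ B :=
    mul_le_mul_of_nonneg_left (by linarith) (sq_nonneg _)
  linarith

/-- Visibility: distinct boundary points are joined by a geodesic line. -/
theorem IsCATNegOne.exists_liesOnGeodesic [ProperSpace X] (hX : IsCATNegOne X)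
    {ξ ξ' : GromovBoundary X} (hne : ξ ≠ ξ') : ∃ z, LiesOnGeodesic ξ ξ' z := by
  obtain ⟨c, rfl⟩ := GeodesicRay.exists_endpoint_eq ξ
  obtain ⟨c', rfl⟩ := GeodesicRay.exists_endpoint_eq ξ'
  set o := c.1 0 with ho
  have hδ := hX.gromovHyperbolic
  obtain ⟨M, hM⟩ := GeodesicRay.exists_gprod_le hδ hne o
  choose γ h0 h1 h using fun n : ℕ => hX.exists_geodesic (c.1 n) (c'.1 n)
  set D : ℕ → ℝ := fun n => dist (c.1 n) (c'.1 n) with hD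
  -- At parameter `a n` both bounds in `dist_le_max` equal the Gromov product of `c n` and `c' n`,
  -- which is at most `M`. The segments recentred there stay near `o`, so they have a limit line.
  set a : ℕ → ℝ := fun n => (D n + dist o (c.1 n) - dist o (c'.1 n)) / 2 with ha
  have ha0 : ∀ n, 0 ≤ a n := fun n => by
    have := dist_triangle o (c.1 n) (c'.1 n)
    simp only [ha, hD]; linarith
  have ha1 : ∀ n, a n ≤ D n := fun n => by
    have := dist_triangle o (c'.1 n) (c.1 n)
    rw [dist_comm (c'.1 n)] at this
    simp only [ha, hD]; linarith
  have hDn : ∀ n, 0 ≤ D n := fun n => dist_nonneg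
  have d0 : ∀ n, ∀ s ∈ Set.Icc 0 (D n), dist (γ n s) (c.1 n) = s := fun n s hs => by
    conv_lhs => rw [← h0 n, h n s hs 0 ⟨le_rfl, hDn n⟩]
    simp [abs_of_nonneg hs.1]
  have d1 : ∀ n, ∀ s ∈ Set.Icc 0 (D n), dist (γ n s) (c'.1 n) = D n - s := fun n s hs => by
    conv_lhs => rw [← h1 n, h n s hs _ ⟨hDn n, le_rfl⟩]
    rw [abs_sub_comm, abs_of_nonneg]
    have := hs.2
    simp only [hD] at this
    linarith
  set M' := M + 2 * Real.log 2 with hM'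
  have hm : ∀ n, dist (γ n (a n)) o ≤ M' := fun n => by
    have e0 := d0 n (a n) ⟨ha0 n, ha1 n⟩
    have e1 := d1 n (a n) ⟨ha0 n, ha1 n⟩
    have := hX.dist_le_max o (x := c.1 n) (y := c'.1 n) (m := γ n (a n))
      (by rw [dist_comm (c.1 n), e0, e1]; ring)
    rw [dist_comm (c.1 n), e0, e1] at this
    have e2 : dist o (c.1 n) - a n = gprod o (c.1 n) (c'.1 n) := by
      simp only [ha, hD, gprod, dist_comm _ o]; ring
    have e3 : dist o (c'.1 n) - (D n - a n) = gprod o (c.1 n) (c'.1 n) := by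
      simp only [ha, hD, gprod, dist_comm _ o]; ring
    rw [e2, e3, max_self, dist_comm] at this
    linarith [hM n n]
  have ta : Tendsto a atTop atTop := by
    refine tendsto_atTop_mono (f := fun n : ℕ => (n : ℝ) - (dist (c.1 0) o + M')) (fun n => ?_)
      (tendsto_atTop_add_const_right _ _ tendsto_natCast_atTop_atTop)
    have e0 := d0 n (a n) ⟨ha0 n, ha1 n⟩
    have e1 := c.le_dist o n
    rw [NNReal.coe_natCast] at e1
    linarith [hm n, dist_triangle (c.1 n) (γ n (a n)) o, dist_comm (c.1 n) (γ n (a n))]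
  have tb : Tendsto (fun n => D n - a n) atTop atTop := by
    refine tendsto_atTop_mono (f := fun n : ℕ => (n : ℝ) - (dist (c'.1 0) o + M')) (fun n => ?_)
      (tendsto_atTop_add_const_right _ _ tendsto_natCast_atTop_atTop)
    have e0 := d1 n (a n) ⟨ha0 n, ha1 n⟩
    have e1 := c'.le_dist o n
    rw [NNReal.coe_natCast] at e1
    linarith [hm n, dist_triangle (c'.1 n) (γ n (a n)) o, dist_comm (c'.1 n) (γ n (a n))]
  have hmem : ∀ s : ℝ, ∀ᶠ n in atTop, a n + s ∈ Set.Icc 0 (D n) := fun s => by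
    filter_upwards [ta.eventually_ge_atTop (-s), tb.eventually_ge_atTop s] with n h1 h2
    exact ⟨by linarith, by linarith⟩
  obtain ⟨g, hg, hlim⟩ := exists_isometry_tendsto_hyperfilter (Γ := fun n (s : ℝ) => γ n (a n + s))
    (fun s t => by
      filter_upwards [hmem s, hmem t] with n hs ht
      rw [h n _ hs _ ht, Real.dist_eq]; congr 1; ring) 0 o (M := M') (by simp [hm])
  refine ⟨g 0, g, hg, ?_, ?_, 0, rfl⟩
  · refine GeodesicRay.endpoint_eq_iff.2
      ⟨4 * (M' + dist (c.1 0) o) + 2 * (2 * Real.log 2), fun s => ?_⟩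
    refine le_of_tendsto ((hlim (-s)).dist tendsto_const_nhds) ?_
    filter_upwards [Nat.hyperfilter_le_atTop (hmem (-s)),
      Nat.hyperfilter_le_atTop (eventually_ge_atTop ⌈s⌉₊)] with n hn h2
    refine (hδ.dist_ray_le c (o := o) (m := γ n (a n)) (n := (n : ℝ≥0))
      (Nat.ceil_le.1 h2) ?_ ?_).trans (by linarith [hm n])
    · rw [h n _ hn _ ⟨ha0 n, ha1 n⟩]; simp
    · rw [d0 n _ hn, d0 n _ ⟨ha0 n, ha1 n⟩]; ring
  · refine GeodesicRay.endpoint_eq_iff.2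
      ⟨4 * (M' + dist (c'.1 0) o) + 2 * (2 * Real.log 2), fun s => ?_⟩
    refine le_of_tendsto ((hlim s).dist tendsto_const_nhds) ?_
    filter_upwards [Nat.hyperfilter_le_atTop (hmem s),
      Nat.hyperfilter_le_atTop (eventually_ge_atTop ⌈s⌉₊)] with n hn h2
    refine (hδ.dist_ray_le c' (o := o) (m := γ n (a n)) (n := (n : ℝ≥0))
      (Nat.ceil_le.1 h2) ?_ ?_).trans (by linarith [hm n])
    · rw [h n _ hn _ ⟨ha0 n, ha1 n⟩]; simp
    · rw [d1 n _ hn, d1 n _ ⟨ha0 n, ha1 n⟩]; ring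

end Rays

/-! ### Orbits of a single isometry -/

section Orbits

variable {X : Type*} [MetricSpace X]

theorem dist_pow_apply_le (p : X ≃ᵢ X) (o : X) (k : ℕ) :
    dist o ((p ^ k) o) ≤ k * dist o (p o) := by
  induction k with
  | zero => simp
  | succ k ih =>
    have e : (p ^ (k + 1)) o = (p ^ k) (p o) := by rw [pow_succ]; rfl
    have := dist_triangle o ((p ^ k) o) ((p ^ (k + 1)) o)
    rw [e, (p ^ k).isometry.dist_eq] at this
    rw [e]; push_cast; linarith

theorem dist_zpow_apply (p : X ≃ᵢ X) (o : X) (i j : ℤ) :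
    dist ((p ^ i) o) ((p ^ j) o) = dist o ((p ^ (j - i)) o) := by
  have : (p ^ j) o = (p ^ i) ((p ^ (j - i)) o) := by
    rw [← IsometryEquiv.mul_apply, ← zpow_add]; simp
  rw [this, (p ^ i).isometry.dist_eq]

/-- Całka's theorem: an orbit of an isometry of a proper space with a bounded subsequence is
bounded. -/
theorem exists_dist_pow_le_of_not_tendsto [ProperSpace X] (p : X ≃ᵢ X) (o : X)
    (h : ¬ Tendsto (fun k : ℕ => dist o ((p ^ k) o)) atTop atTop) :
    ∃ C, ∀ k : ℕ, dist o ((p ^ k) o) ≤ C := by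
  -- Two late terms of a convergent subsequence of the orbit are close; the difference of their
  -- exponents is a return time to the unit ball around `o`.
  have hrec : ∀ n₀ : ℕ, ∃ n : ℕ, n₀ < n ∧ dist o ((p ^ n) o) < 1 := by
    rw [tendsto_atTop] at h
    push Not at h
    obtain ⟨b, hb⟩ := h
    obtain ⟨φ, hφ, hφb⟩ := extraction_of_frequently_atTop hb
    obtain ⟨a, -, ψ, hψ, hlim⟩ := (isCompact_closedBall o b).tendsto_subseq
      (x := fun k => (p ^ φ k) o) (fun k => by
        rw [Metric.mem_closedBall, dist_comm]; exact (not_le.1 (by simpa using hφb k)).le)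
    obtain ⟨N, hN⟩ := Metric.cauchySeq_iff.1 hlim.cauchySeq 1 one_pos
    intro n₀
    set i := φ (ψ N)
    set j := φ (ψ (N + (i + n₀ + 1)))
    have hj : i + n₀ < j := by
      have := (hφ.comp hψ).id_le (N + (i + n₀ + 1))
      simp only [id, Function.comp] at this
      omega
    have hd := hN N le_rfl (N + (i + n₀ + 1)) (by omega)
    refine ⟨j - i, by omega, ?_⟩
    have := dist_zpow_apply p o i j
    rw [show (j : ℤ) - i = ((j - i : ℕ) : ℤ) by push_cast [show i ≤ j by omega]; ring] at this
    simp only [zpow_natCast] at this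
    rw [← this]
    exact hd
  set S : Set X := {y | ∃ k : ℤ, y = (p ^ k) o ∧ dist o y < 2} with hS
  have htb : TotallyBounded S := by
    refine (isCompact_closedBall o 2).totallyBounded.subset ?_
    rintro y ⟨k, -, hy⟩
    rw [Metric.mem_closedBall, dist_comm]; exact hy.le
  obtain ⟨t, htS, htf, htc⟩ := Metric.finite_approx_of_totallyBounded htb 1 one_pos
  choose! f hf using fun y (hy : y ∈ t) => htS hy
  obtain ⟨B, hB⟩ : ∃ B : ℤ, ∀ y ∈ t, |f y| ≤ B := by
    obtain ⟨B, hB⟩ := (htf.image fun y => |f y|).bddAbove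
    exact ⟨B, fun y hy => hB ⟨y, hy, rfl⟩⟩
  obtain ⟨n, hn, hn1⟩ := hrec B.toNat
  have hnB : B < n := by have := Int.self_le_toNat B; omega
  -- Let `p^v o` be within 1 of the net point `p^(f y) o`. Then `p^(v - f y) o` is within 1 of `o`,
  -- and applying `p^n` keeps it within 2. Since `|f y| ≤ B < n`, the exponent grows, by at most `n
  -- + B`.
  have step : ∀ v : ℤ, dist o ((p ^ v) o) < 2 → ∃ w : ℤ, v < w ∧ w ≤ v + (n + B) ∧
      dist o ((p ^ w) o) < 2 := by
    intro v hv
    have hvS : (p ^ v) o ∈ S := ⟨v, rfl, hv⟩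
    have := htc hvS
    simp only [Set.mem_iUnion, Metric.mem_ball, exists_prop] at this
    obtain ⟨y, hy, hyd⟩ := this
    have hfy := hB y hy
    rw [abs_le] at hfy
    refine ⟨v + (n - f y), by linarith, by linarith, ?_⟩
    rw [(hf y hy).1, dist_comm, dist_zpow_apply] at hyd
    have e1 : dist ((p ^ (n : ℤ)) o) ((p ^ (v + (n - f y))) o) = dist o ((p ^ (v - f y)) o) := by
      rw [dist_zpow_apply]; congr 3; ring
    have e2 : dist o ((p ^ (n : ℤ)) o) < 1 := by simpa using hn1
    linarith [dist_triangle o ((p ^ (n : ℤ)) o) ((p ^ (v + (n - f y))) o)]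
  -- Visits to the ball of radius 2 thus occur with gaps at most `n + B`, and the orbit moves a
  -- bounded distance in between.
  have hcov : ∀ k : ℕ, ∃ v : ℤ, dist o ((p ^ v) o) < 2 ∧ k - (n + B) ≤ v ∧ v ≤ k := by
    intro k
    obtain ⟨y, hy⟩ : ∃ y, y ∈ t := by
      by_contra hcon
      push Not at hcon
      have h0 : o ∈ S := ⟨0, by simp, by simp⟩
      have := htc h0
      simp only [Set.mem_iUnion] at this
      obtain ⟨y, hy, -⟩ := this
      exact hcon y hy
    have hB0 : 0 ≤ B := (abs_nonneg _).trans (hB y hy)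
    induction k with
    | zero => exact ⟨0, by simp, by push_cast; omega, by simp⟩
    | succ k ih =>
      obtain ⟨v, h1, h2, h3⟩ := ih
      by_cases hv : ((k + 1 : ℕ) : ℤ) - (n + B) ≤ v
      · exact ⟨v, h1, hv, by push_cast; omega⟩
      · obtain ⟨w, w1, w2, w3⟩ := step v h1
        push_cast at hv ⊢
        exact ⟨w, w3, by omega, by omega⟩
  refine ⟨2 + (n + B) * dist o (p o), fun k => ?_⟩
  obtain ⟨v, h1, h2, h3⟩ := hcov k
  have e1 := dist_zpow_apply p o v k
  obtain ⟨j, hj⟩ := Int.eq_ofNat_of_zero_le (show 0 ≤ (k : ℤ) - v by omega)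
  rw [hj] at e1
  simp only [zpow_natCast] at e1
  have e2 := dist_pow_apply_le p o j
  have e3 : (j : ℝ) ≤ n + B := by
    have : (j : ℤ) ≤ n + B := by omega
    exact_mod_cast this
  have e4 := mul_le_mul_of_nonneg_right e3 (dist_nonneg (x := o) (y := p o))
  linarith [dist_triangle o ((p ^ v) o) ((p ^ k) o)]

end Orbits

/-! ### Riemannian manifolds are infinitesimally Euclidean -/

section AlmostIsometricChart

open Set MeasureTheory Manifold
open scoped ENNReal

variable {E : Type*} [NormedAddCommGroup E] [NormedSpace ℝ E]
  {M : Type*} [MetricSpace M] [ChartedSpace E M] [IsManifold 𝓘(ℝ, E) ∞ M]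

/-- The linear part at `x` of the inverse of the preferred chart at `x`. -/
noncomputable def chartFrame (x : M) : E ≃L[ℝ] TangentSpace 𝓘(ℝ, E) x :=
  ((trivializationAt E (TangentSpace 𝓘(ℝ, E)) x).continuousLinearEquivAt ℝ x
    (FiberBundle.mem_baseSet_trivializationAt' x)).symm

theorem chartFrame_apply (x : M) (v : E) :
    chartFrame x v = (trivializationAt E (TangentSpace 𝓘(ℝ, E)) x).symmL ℝ x v :=
  congrFun ((trivializationAt E (TangentSpace 𝓘(ℝ, E)) x).symm_continuousLinearEquivAt_eq
    (FiberBundle.mem_baseSet_trivializationAt' x)) v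

theorem continuousLinearMapAt_chartFrame (x : M) (v : E) :
    (trivializationAt E (TangentSpace 𝓘(ℝ, E)) x).continuousLinearMapAt ℝ x
      (chartFrame x v) = v := by
  rw [chartFrame_apply]
  exact (trivializationAt E (TangentSpace 𝓘(ℝ, E)) x).continuousLinearMapAt_symmL
    (FiberBundle.mem_baseSet_trivializationAt' x) v

variable [RiemannianBundle (fun x : M => TangentSpace 𝓘(ℝ, E) x)]

theorem isContinuousRiemannianBundle_tangentSpace
    [h : IsContMDiffRiemannianBundle 𝓘(ℝ, E) ∞ E (fun x : M => TangentSpace 𝓘(ℝ, E) x)] :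
    IsContinuousRiemannianBundle E (fun x : M => TangentSpace 𝓘(ℝ, E) x) := by
  obtain ⟨g, hg, hg'⟩ := h.exists_contMDiff
  exact ⟨g, hg.continuous, hg'⟩

/-- The norm of a vector in the preferred chart at `x`, measured with the metric at `x`. -/
noncomputable def chartNorm (x : M) (v : E) : ℝ := ‖chartFrame x v‖

/-- The Riemannian norm at `y` of a vector of the model space, seen as a tangent vector. -/
noncomputable def tangentNorm (y : M) (v : E) : ℝ :=
  norm (E := TangentSpace 𝓘(ℝ, E) y) v

/-- In the tangent bundle the derivative of the chart is the trivialization itself, so this is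
continuity of the metric at `x`. -/
theorem eventually_chartNorm_mfderiv_le
    [IsContMDiffRiemannianBundle 𝓘(ℝ, E) ∞ E (fun x : M => TangentSpace 𝓘(ℝ, E) x)]
    (x : M) {r : ℝ} (hr : 1 < r) :
    ∀ᶠ y in 𝓝 x, ∀ v : TangentSpace 𝓘(ℝ, E) y,
      chartNorm (E := E) x (mfderiv 𝓘(ℝ, E) 𝓘(ℝ, E) (extChartAt 𝓘(ℝ, E) x) y v) ≤ r * ‖v‖ := by
  have := isContinuousRiemannianBundle_tangentSpace (E := E) (M := M)
  filter_upwards [eventually_norm_symmL_trivializationAt_self_comp_lt E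
    (fun x : M => TangentSpace 𝓘(ℝ, E) x) x hr, chart_source_mem_nhds E x] with y hy h'y v
  have h1 := ContinuousLinearMap.le_of_opNorm_le _ hy.le v
  rw [ContinuousLinearMap.comp_apply] at h1
  rw [← TangentBundle.continuousLinearMapAt_trivializationAt h'y]
  refine le_of_eq_of_le ?_ h1
  exact congrArg norm (chartFrame_apply x _)

theorem eventually_tangentNorm_mfderivWithin_symm_le
    [IsContMDiffRiemannianBundle 𝓘(ℝ, E) ∞ E (fun x : M => TangentSpace 𝓘(ℝ, E) x)]
    (x : M) {r : ℝ} (hr : 1 < r) :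
    ∀ᶠ y in 𝓝 (extChartAt 𝓘(ℝ, E) x x), ∀ v : E,
      tangentNorm (E := E) ((extChartAt 𝓘(ℝ, E) x).symm y) ((mfderivWithin 𝓘(ℝ, E) 𝓘(ℝ, E)
        (extChartAt 𝓘(ℝ, E) x).symm (range 𝓘(ℝ, E)) y : E → E) v) ≤ r * chartNorm x v := by
  have := isContinuousRiemannianBundle_tangentSpace (E := E) (M := M)
  have key : ∀ᶠ y in 𝓝 x, ∀ v : E,
      tangentNorm (E := E) y ((mfderivWithin 𝓘(ℝ, E) 𝓘(ℝ, E)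
        (extChartAt 𝓘(ℝ, E) x).symm (range 𝓘(ℝ, E)) (extChartAt 𝓘(ℝ, E) x y) : E → E) v)
        ≤ r * chartNorm x v := by
    filter_upwards [eventually_norm_symmL_trivializationAt_comp_self_lt E
      (fun x : M => TangentSpace 𝓘(ℝ, E) x) x hr, chart_source_mem_nhds E x] with y hy h'y v
    have h1 := ContinuousLinearMap.le_of_opNorm_le _ hy.le (chartFrame x v)
    rw [ContinuousLinearMap.comp_apply, continuousLinearMapAt_chartFrame] at h1
    have h2 : ((mfderivWithin 𝓘(ℝ, E) 𝓘(ℝ, E)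
        (extChartAt 𝓘(ℝ, E) x).symm (range 𝓘(ℝ, E)) (extChartAt 𝓘(ℝ, E) x y) : E → E) v) =
        (trivializationAt E (TangentSpace 𝓘(ℝ, E)) x).symmL ℝ y v :=
      congrArg (fun f : E →L[ℝ] E => f v)
        (TangentBundle.symmL_trivializationAt (𝕜 := ℝ) (I := 𝓘(ℝ, E)) h'y).symm
    rw [h2]
    exact h1
  have hx : (extChartAt 𝓘(ℝ, E) x).symm (extChartAt 𝓘(ℝ, E) x x) = x :=
    extChartAt_to_inv x
  have hc : ContinuousAt (extChartAt 𝓘(ℝ, E) x).symm (extChartAt 𝓘(ℝ, E) x x) :=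
    continuousAt_extChartAt_symm x
  rw [ContinuousAt, hx] at hc
  filter_upwards [hc.eventually key, extChartAt_target_mem_nhds (I := 𝓘(ℝ, E)) x] with y hy h'y v
  have := hy v
  rwa [(extChartAt 𝓘(ℝ, E) x).right_inv h'y] at this

/-- Push a path from `a` to `b` of length less than `d` forward by the chart and integrate the
derivative bound; then let `d` decrease to `dist a b`, as a shortest path is not at hand. -/
theorem eventually_norm_chartFrame_sub_le
    [IsContMDiffRiemannianBundle 𝓘(ℝ, E) ∞ E (fun x : M => TangentSpace 𝓘(ℝ, E) x)]
    [IsRiemannianManifold 𝓘(ℝ, E) M] (x : M) {r : ℝ} (hr : 1 < r) :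
    ∃ δ > 0, ∀ a ∈ Metric.ball x δ, ∀ b ∈ Metric.ball x δ,
      chartNorm x (extChartAt 𝓘(ℝ, E) x b - extChartAt 𝓘(ℝ, E) x a) ≤ r * dist a b := by
  obtain ⟨δ, hδ, hball⟩ := Metric.mem_nhds_iff.1 (inter_mem
    (eventually_chartNorm_mfderiv_le (E := E) x hr) (chart_source_mem_nhds E x))
  refine ⟨δ / 3, by positivity, fun a ha b hb => ?_⟩
  rw [Metric.mem_ball] at ha hb
  have hab : dist a b < 2 * δ / 3 := by
    linarith [dist_triangle a x b, dist_comm x b]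
  have main : ∀ d, dist a b < d → d < 2 * δ / 3 →
      chartNorm x (extChartAt 𝓘(ℝ, E) x b - extChartAt 𝓘(ℝ, E) x a) ≤ r * d := by
    intro d hd hd'
    have hd0 : 0 < d := dist_nonneg.trans_lt hd
    have hlt : riemannianEDist 𝓘(ℝ, E) a b < ENNReal.ofReal d := by
      rw [← IsRiemannianManifold.out (I := 𝓘(ℝ, E)) a b, edist_dist]
      exact (ENNReal.ofReal_lt_ofReal_iff hd0).2 hd
    obtain ⟨γ, h0, h1, hγ, hlen, -⟩ :=
      exists_lt_locally_constant_of_riemannianEDist_lt hlt zero_lt_one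
    -- The path stays within `d < 2δ/3` of `a`, and `a` is within `δ/3` of `x`; this is the reason
    -- for the radius `δ/3`.
    have hmem : ∀ t ∈ Icc (0 : ℝ) 1, γ t ∈ Metric.ball x δ := by
      intro t ht
      have e1 : edist a (γ t) < ENNReal.ofReal d := by
        rw [IsRiemannianManifold.out (I := 𝓘(ℝ, E)) a (γ t)]
        refine ((riemannianEDist_le_pathELength hγ.contMDiffOn h0 rfl ht.1).trans
          (pathELength_mono le_rfl ht.2)).trans_lt hlen
      rw [edist_dist, ENNReal.ofReal_lt_ofReal_iff hd0] at e1
      rw [Metric.mem_ball]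
      linarith [dist_triangle (γ t) a x, dist_comm a (γ t)]
    set φ := extChartAt 𝓘(ℝ, E) x with hφ
    have hsrc : ∀ t ∈ Icc (0 : ℝ) 1, γ t ∈ (chartAt E x).source := fun t ht =>
      (hball (hmem t ht)).2
    have hsm : ContMDiffOn 𝓘(ℝ, ℝ) 𝓘(ℝ, E) 1 (φ ∘ γ) (Icc 0 1) :=
      contMDiffOn_extChartAt.comp (I' := 𝓘(ℝ, E)) (t := (chartAt E x).source)
        hγ.contMDiffOn hsrc
    have hsm' : ContDiffOn ℝ 1 (φ ∘ γ) (Icc 0 1) := contMDiffOn_iff_contDiffOn.1 hsm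
    let L : E →L[ℝ] TangentSpace 𝓘(ℝ, E) x := (chartFrame x : E ≃L[ℝ] TangentSpace 𝓘(ℝ, E) x)
    have hG : ContDiffOn ℝ 1 (fun t => L ((φ ∘ γ) t)) (Icc 0 1) :=
      L.contDiff.comp_contDiffOn hsm'
    have hderiv : ∀ t ∈ Icc (0 : ℝ) 1, derivWithin (fun t => L ((φ ∘ γ) t)) (Icc 0 1) t =
        L (derivWithin (φ ∘ γ) (Icc 0 1) t) := by
      intro t ht
      have hd1 : HasDerivWithinAt (φ ∘ γ) (derivWithin (φ ∘ γ) (Icc 0 1) t) (Icc 0 1) t :=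
        ((hsm'.differentiableOn one_ne_zero) t ht).hasDerivWithinAt
      exact (L.hasFDerivAt.comp_hasDerivWithinAt t hd1).derivWithin
        (uniqueDiffOn_Icc zero_lt_one t ht)
    have hchain : ∀ t ∈ Icc (0 : ℝ) 1, derivWithin (φ ∘ γ) (Icc 0 1) t =
        (mfderiv 𝓘(ℝ, E) 𝓘(ℝ, E) φ (γ t) : E → E)
          (mfderivWithin 𝓘(ℝ, ℝ) 𝓘(ℝ, E) γ (Icc 0 1) t (1 : ℝ)) := by
      intro t ht
      have e1 : mfderivWithin 𝓘(ℝ, ℝ) 𝓘(ℝ, E) (φ ∘ γ) (Icc 0 1) t =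
          (mfderiv 𝓘(ℝ, E) 𝓘(ℝ, E) φ (γ t)).comp
            (mfderivWithin 𝓘(ℝ, ℝ) 𝓘(ℝ, E) γ (Icc 0 1) t) := by
        apply mfderiv_comp_mfderivWithin
        · exact mdifferentiableAt_extChartAt (hsrc t ht)
        · exact (hγ.mdifferentiable one_ne_zero).mdifferentiableOn _ ht
        · rw [uniqueMDiffWithinAt_iff_uniqueDiffWithinAt]
          exact uniqueDiffOn_Icc zero_lt_one _ ht
      rw [← fderivWithin_derivWithin, ← mfderivWithin_eq_fderivWithin]
      exact congrArg (fun f : ℝ →L[ℝ] E => f 1) e1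
    have key : ‖L ((φ ∘ γ) 1) - L ((φ ∘ γ) 0)‖ₑ ≤ ENNReal.ofReal r * ENNReal.ofReal d := by
      calc ‖L ((φ ∘ γ) 1) - L ((φ ∘ γ) 0)‖ₑ
          ≤ ∫⁻ t in Icc 0 1, ‖derivWithin (fun t => L ((φ ∘ γ) t)) (Icc 0 1) t‖ₑ :=
            enorm_sub_le_lintegral_derivWithin_Icc_of_contDiffOn_Icc hG zero_le_one
        _ ≤ ∫⁻ t in Icc 0 1, ENNReal.ofReal r *
              ‖mfderivWithin 𝓘(ℝ, ℝ) 𝓘(ℝ, E) γ (Icc 0 1) t (1 : ℝ)‖ₑ := by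
            refine setLIntegral_mono' measurableSet_Icc fun t ht => ?_
            rw [hderiv t ht, hchain t ht, ← ofReal_norm, ← ofReal_norm,
              ← ENNReal.ofReal_mul (by linarith)]
            exact ENNReal.ofReal_le_ofReal ((hball (hmem t ht)).1 _)
        _ = ENNReal.ofReal r * pathELength 𝓘(ℝ, E) γ 0 1 := by
            rw [lintegral_const_mul' _ _ ENNReal.ofReal_ne_top,
              pathELength_eq_lintegral_mfderivWithin_Icc]
            rfl
        _ ≤ _ := by gcongr
    rw [← ofReal_norm, ← ENNReal.ofReal_mul (by linarith),
      ENNReal.ofReal_le_ofReal_iff (by positivity), ← map_sub] at key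
    simp only [Function.comp_apply, h0, h1] at key
    exact key
  have hlim : Tendsto (fun d => r * d) (𝓝[>] dist a b) (𝓝 (r * dist a b)) :=
    ((continuous_const.mul continuous_id).tendsto _).mono_left nhdsWithin_le_nhds
  refine ge_of_tendsto hlim ?_
  filter_upwards [self_mem_nhdsWithin, mem_nhdsWithin_of_mem_nhds (Iio_mem_nhds hab)] with d h1 h2
    using main d h1 h2

/-- The straight segment from `u` to `v` in the chart gives a path in the manifold whose length
bounds the distance. -/
theorem eventually_dist_symm_le_chartNorm
    [IsContMDiffRiemannianBundle 𝓘(ℝ, E) ∞ E (fun x : M => TangentSpace 𝓘(ℝ, E) x)]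
    [IsRiemannianManifold 𝓘(ℝ, E) M] (x : M) {r : ℝ} (hr : 1 < r) :
    ∃ δ > 0, ∀ u ∈ Metric.ball (extChartAt 𝓘(ℝ, E) x x) δ,
      u ∈ (extChartAt 𝓘(ℝ, E) x).target ∧ ∀ v ∈ Metric.ball (extChartAt 𝓘(ℝ, E) x x) δ,
        dist ((extChartAt 𝓘(ℝ, E) x).symm u) ((extChartAt 𝓘(ℝ, E) x).symm v) ≤
          r * chartNorm x (v - u) := by
  obtain ⟨δ, hδ, hball⟩ := Metric.mem_nhds_iff.1 (inter_mem
    (eventually_tangentNorm_mfderivWithin_symm_le (E := E) x hr)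
    (extChartAt_target_mem_nhds (I := 𝓘(ℝ, E)) x))
  refine ⟨δ, hδ, fun u hu => ⟨(hball hu).2, fun v hv => ?_⟩⟩
  set φ := extChartAt 𝓘(ℝ, E) x with hφ
  let η : ℝ →ᴬ[ℝ] E := ContinuousAffineMap.lineMap (R := ℝ) u v
  have hη : ∀ t ∈ Icc (0 : ℝ) 1, η t ∈ Metric.ball (φ x) δ := by
    intro t ht
    refine (convex_ball (φ x) δ).segment_subset hu hv ?_
    rw [segment_eq_image_lineMap]
    exact ⟨t, ht, rfl⟩
  have hηsm : ContMDiffOn 𝓘(ℝ, ℝ) 𝓘(ℝ, E) 1 η (Icc 0 1) := by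
    apply ContMDiff.contMDiffOn
    rw [contMDiff_iff_contDiff]
    exact ContinuousAffineMap.contDiff _
  have htarget : Icc (0 : ℝ) 1 ⊆ η ⁻¹' φ.target := fun t ht => (hball (hη t ht)).2
  have hγsm : ContMDiffOn 𝓘(ℝ, ℝ) 𝓘(ℝ, E) 1 (φ.symm ∘ η) (Icc 0 1) :=
    (contMDiffOn_extChartAt_symm x).comp hηsm htarget
  have hle : riemannianEDist 𝓘(ℝ, E) (φ.symm u) (φ.symm v) ≤
      pathELength 𝓘(ℝ, E) (φ.symm ∘ η) 0 1 := by
    apply riemannianEDist_le_pathELength hγsm _ _ zero_le_one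
    · simp [η, ContinuousAffineMap.coe_lineMap_eq]
    · simp [η, ContinuousAffineMap.coe_lineMap_eq]
  have hr0 : 0 ≤ r * chartNorm x (v - u) := by
    unfold chartNorm; positivity
  have hηd : ∀ t ∈ Icc (0 : ℝ) 1,
      (mfderivWithin 𝓘(ℝ, ℝ) 𝓘(ℝ, E) η (Icc 0 1) t : ℝ → E) (1 : ℝ) = v - u := by
    intro t ht
    rw [mfderivWithin_eq_fderivWithin, fderivWithin_eq_fderiv (uniqueDiffOn_Icc zero_lt_one t ht)
      (ContinuousAffineMap.differentiableAt _)]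
    have e := η.contLinear_map_vsub (1 : ℝ) 0
    have e1 : η 1 = v := by simp [η, ContinuousAffineMap.coe_lineMap_eq]
    have e0 : η 0 = u := by simp [η, ContinuousAffineMap.coe_lineMap_eq]
    rw [e0, e1, vsub_eq_sub, vsub_eq_sub, sub_zero] at e
    exact Eq.trans (by simp; rfl) e
  have hlen : pathELength 𝓘(ℝ, E) (φ.symm ∘ η) 0 1 ≤ ENNReal.ofReal (r * chartNorm x (v - u)) := by
    rw [pathELength_eq_lintegral_mfderivWithin_Icc]
    calc _ ≤ ∫⁻ t in Icc (0 : ℝ) 1, ENNReal.ofReal (r * chartNorm x (v - u)) := by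
          refine setLIntegral_mono' measurableSet_Icc fun t ht => ?_
          have e1 : mfderivWithin 𝓘(ℝ, ℝ) 𝓘(ℝ, E) (φ.symm ∘ η) (Icc 0 1) t =
              (mfderivWithin 𝓘(ℝ, E) 𝓘(ℝ, E) φ.symm (range 𝓘(ℝ, E)) (η t)).comp
                (mfderivWithin 𝓘(ℝ, ℝ) 𝓘(ℝ, E) η (Icc 0 1) t) := by
            apply mfderivWithin_comp
            · exact mdifferentiableWithinAt_extChartAt_symm (htarget ht)
            · exact hηsm.mdifferentiableOn one_ne_zero t ht
            · exact htarget.trans (preimage_mono (extChartAt_target_subset_range x))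
            · rw [uniqueMDiffWithinAt_iff_uniqueDiffWithinAt]
              exact uniqueDiffOn_Icc zero_lt_one t ht
          have e2 : (mfderivWithin 𝓘(ℝ, ℝ) 𝓘(ℝ, E) (φ.symm ∘ η) (Icc 0 1) t : ℝ → E) (1 : ℝ) =
              (mfderivWithin 𝓘(ℝ, E) 𝓘(ℝ, E) φ.symm (range 𝓘(ℝ, E)) (η t) : E → E)
                (v - u) := by
            rw [← hηd t ht]
            exact congrArg (fun f : ℝ →L[ℝ] E => f 1) e1
          have e3 := (hball (hη t ht)).1 (v - u)
          rw [← e2] at e3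
          rw [← ofReal_norm]
          exact ENNReal.ofReal_le_ofReal e3
      _ = ENNReal.ofReal (r * chartNorm x (v - u)) := by simp
  have h := hle.trans hlen
  rw [← IsRiemannianManifold.out (I := 𝓘(ℝ, E)), edist_dist,
    ENNReal.ofReal_le_ofReal_iff hr0] at h
  exact h

/-- Around each point, a Riemannian manifold is almost isometric to its tangent space. -/
theorem exists_almost_isometric_chart
    [IsContMDiffRiemannianBundle 𝓘(ℝ, E) ∞ E (fun x : M => TangentSpace 𝓘(ℝ, E) x)]
    [IsRiemannianManifold 𝓘(ℝ, E) M] (x : M) {r : ℝ} (hr : 1 < r) :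
    ∃ f : M → TangentSpace 𝓘(ℝ, E) x, f x = 0 ∧ ∃ δ > 0,
      (∀ a ∈ Metric.ball x δ, ∀ b ∈ Metric.ball x δ,
        ‖f b - f a‖ ≤ r * dist a b ∧ dist a b ≤ r * ‖f b - f a‖) ∧
      ∃ ρ > 0, ∀ v : TangentSpace 𝓘(ℝ, E) x, ‖v‖ < ρ → ∃ a ∈ Metric.ball x δ, f a = v := by
  set φ := extChartAt 𝓘(ℝ, E) x with hφ
  let L : E ≃L[ℝ] TangentSpace 𝓘(ℝ, E) x := chartFrame x
  obtain ⟨δ₁, hδ₁, h1⟩ := eventually_norm_chartFrame_sub_le (E := E) x hr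
  obtain ⟨δ₂, hδ₂, h2⟩ := eventually_dist_symm_le_chartNorm (E := E) x hr
  have hcont : ContinuousAt φ x := continuousAt_extChartAt x
  obtain ⟨δ₃, hδ₃, h3⟩ := Metric.mem_nhds_iff.1 (inter_mem
    (hcont.preimage_mem_nhds (Metric.ball_mem_nhds (φ x) hδ₂))
    (extChartAt_source_mem_nhds (I := 𝓘(ℝ, E)) x))
  have hL : ∀ a b, L (φ b - φ x) - L (φ a - φ x) = L (φ b - φ a) := fun a b => by
    rw [← map_sub]; congr 1; abel
  refine ⟨fun a => L (φ a - φ x), by simp, min δ₁ δ₃, lt_min hδ₁ hδ₃, fun a ha b hb => ?_, ?_⟩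
  · have ha1 := Metric.ball_subset_ball (min_le_left _ _) ha
    have hb1 := Metric.ball_subset_ball (min_le_left _ _) hb
    have ha3 := h3 (Metric.ball_subset_ball (min_le_right _ _) ha)
    have hb3 := h3 (Metric.ball_subset_ball (min_le_right _ _) hb)
    have e := (h2 _ ha3.1).2 _ hb3.1
    rw [φ.left_inv ha3.2, φ.left_inv hb3.2] at e
    simp only
    rw [hL]
    exact ⟨h1 a ha1 b hb1, e⟩
  · have hsymm : ContinuousAt φ.symm (φ x) := continuousAt_extChartAt_symm x
    have hxs : φ.symm (φ x) = x := extChartAt_to_inv x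
    have hg : ContinuousAt (fun v : TangentSpace 𝓘(ℝ, E) x => φ.symm (φ x + L.symm v)) 0 := by
      have h0 : φ x + L.symm 0 = φ x := by simp
      refine ContinuousAt.comp (g := φ.symm) (by rw [h0]; exact hsymm) ?_
      exact (continuous_const.add L.symm.continuous).continuousAt
    have hev1 := hg.preimage_mem_nhds (t := Metric.ball x (min δ₁ δ₃)) (by
      simp only [map_zero, add_zero, hxs]
      exact Metric.ball_mem_nhds x (lt_min hδ₁ hδ₃))
    have hg2 : ContinuousAt (fun v : TangentSpace 𝓘(ℝ, E) x => φ x + L.symm v) 0 :=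
      (continuous_const.add L.symm.continuous).continuousAt
    have hev2 := hg2.preimage_mem_nhds (t := φ.target) (by
      simp only [map_zero, add_zero]
      exact extChartAt_target_mem_nhds (I := 𝓘(ℝ, E)) x)
    obtain ⟨ρ, hρ, hsub⟩ := Metric.mem_nhds_iff.1 (inter_mem hev1 hev2)
    refine ⟨ρ, hρ, fun v hv => ?_⟩
    have hmem := hsub (show v ∈ Metric.ball 0 ρ by rwa [mem_ball_zero_iff])
    refine ⟨_, hmem.1, ?_⟩
    simp only
    rw [φ.right_inv hmem.2]
    simp

end AlmostIsometricChart

/-! ### Fixed points of isometries and divergence of the displacement -/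

section FixedPoints

theorem Real.cosh_add_sinh_mul_sub_le (a b : ℝ) :
    Real.cosh a + Real.sinh a * (b - a) ≤ Real.cosh b := by
  have h1 : Real.exp a * (1 + (b - a)) ≤ Real.exp b := by
    have := mul_le_mul_of_nonneg_left (Real.add_one_le_exp (b - a)) (Real.exp_pos a).le
    rw [← Real.exp_add, add_sub_cancel] at this
    linarith
  have h2 : Real.exp (-a) * (1 - (b - a)) ≤ Real.exp (-b) := by
    have := mul_le_mul_of_nonneg_left (Real.add_one_le_exp (-(b - a))) (Real.exp_pos (-a)).le
    rw [← Real.exp_add, show -a + -(b - a) = -b by ring] at this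
    linarith
  rw [Real.cosh_eq, Real.cosh_eq, Real.sinh_eq]
  linarith

theorem zpow_apply_eq_self {X : Type*} [MetricSpace X] {p : X ≃ᵢ X} {x : X} (hx : p x = x)
    (k : ℤ) : (p ^ k) x = x := by
  have hnat : ∀ n : ℕ, (p ^ n) x = x := by
    intro n
    induction n with
    | zero => simp
    | succ n ih => rw [pow_succ, IsometryEquiv.mul_apply, hx, ih]
  rcases Int.eq_nat_or_neg k with ⟨n, rfl | rfl⟩
  · rw [zpow_natCast, hnat]
  · rw [zpow_neg, zpow_natCast]
    exact (p ^ n).symm_apply_eq.2 (hnat n).symm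

variable {X : Type*} [MetricSpace X]

/-- If all powers of `p` move `y` within a ball of radius `r` around `y`, then `p` has a fixed point at
distance at most `r` from `y`. -/
theorem IsCATNegOne.exists_fixed_near_orbit [ProperSpace X] (hX : IsCATNegOne X) (p : X ≃ᵢ X)
    {y : X} {r : ℝ} (h : ∀ k : ℤ, dist y ((p ^ k) y) ≤ r) :
    ∃ m, p m = m ∧ dist m y ≤ r := by
  obtain ⟨m, hm, hr⟩ := hX.exists_fixed_circumcenter p (S := Set.range fun k : ℤ => (p ^ k) y)
    (Set.range_nonempty _)
    ((Metric.isBounded_closedBall (x := y) (r := r)).subset (by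
      rintro _ ⟨k, rfl⟩
      rw [Metric.mem_closedBall, dist_comm]
      exact h k)) (by
      rintro _ ⟨k, rfl⟩
      refine ⟨-1 + k, ?_⟩
      simp only
      rw [zpow_add, IsometryEquiv.mul_apply, zpow_neg_one]
      rfl)
  refine ⟨m, hm, hr r ?_ y ⟨0, by simp⟩⟩
  rintro _ ⟨i, rfl⟩ _ ⟨j, rfl⟩
  rw [dist_zpow_apply]
  exact h _

section Riemannian

variable {V : Type*} [NormedAddCommGroup V] [InnerProductSpace ℝ V]

/-- At `r = 1` the radicand vanishes and the three expressions take the values 1, 1, 2. They are the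
errors that an `r`-bilipschitz chart causes in `exists_fixed_antipode`. -/
theorem exists_distortion {ε : ℝ} (hε : 0 < ε) : ∃ r > (1 : ℝ),
    r ^ 2 + r * √(2 * r ^ 6 + 2 * r ^ 2 - 4 / r ^ 6) ≤ 1 + ε ∧
    1 - ε ≤ 1 / r ^ 2 - r * √(2 * r ^ 6 + 2 * r ^ 2 - 4 / r ^ 6) ∧
    2 - ε ≤ 2 / r ^ 2 - r * √(2 * r ^ 6 + 2 * r ^ 2 - 4 / r ^ 6) := by
  set τ : ℝ → ℝ := fun r => √(2 * r ^ 6 + 2 * r ^ 2 - 4 / r ^ 6) with hτ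
  have hτc : ContinuousAt τ 1 := by
    refine ContinuousAt.sqrt (ContinuousAt.sub (by fun_prop) ?_)
    exact continuousAt_const.div (by fun_prop) (by norm_num)
  have hτ1 : τ 1 = 0 := by simp only [hτ]; norm_num
  have c1 : ContinuousAt (fun r => r ^ 2 + r * τ r) 1 := by fun_prop
  have c2 : ContinuousAt (fun r : ℝ => 1 / r ^ 2 - r * τ r) 1 :=
    (continuousAt_const.div (by fun_prop) (by norm_num)).sub (by fun_prop)
  have c3 : ContinuousAt (fun r : ℝ => 2 / r ^ 2 - r * τ r) 1 :=
    (continuousAt_const.div (by fun_prop) (by norm_num)).sub (by fun_prop)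
  have e1 := c1.eventually (Iic_mem_nhds (show (1 : ℝ) ^ 2 + 1 * τ 1 < 1 + ε by
    rw [hτ1]; linarith))
  have e2 := c2.eventually (Ici_mem_nhds (show 1 - ε < 1 / (1 : ℝ) ^ 2 - 1 * τ 1 by
    rw [hτ1]; linarith))
  have e3 := c3.eventually (Ici_mem_nhds (show 2 - ε < 2 / (1 : ℝ) ^ 2 - 1 * τ 1 by
    rw [hτ1]; linarith))
  have e4 : ∀ᶠ r in 𝓝[>] (1 : ℝ), 1 < r := self_mem_nhdsWithin
  obtain ⟨r, hr, h1, h2, h3⟩ := (e4.and (((e1.and (e2.and e3))).filter_mono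
    nhdsWithin_le_nhds)).exists
  exact ⟨r, hr, h1, h2, h3⟩

/-- Suppose that small balls around `x` are almost isometric to Euclidean balls. Then an isometry
fixing `x` and a point `w` close to `x` fixes a point almost opposite to `w`. -/
theorem IsCATNegOne.exists_fixed_antipode [ProperSpace X] (hX : IsCATNegOne X) (x : X)
    (hchart : ∀ r : ℝ, 1 < r → ∃ f : X → V, f x = 0 ∧ ∃ δ > 0,
      (∀ a ∈ Metric.ball x δ, ∀ b ∈ Metric.ball x δ,
        ‖f b - f a‖ ≤ r * dist a b ∧ dist a b ≤ r * ‖f b - f a‖) ∧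
      ∃ ρ > 0, ∀ v : V, ‖v‖ < ρ → ∃ a ∈ Metric.ball x δ, f a = v)
    {ε : ℝ} (hε : 0 < ε) :
    ∃ δ > 0, ∀ (p : X ≃ᵢ X) (w : X), p x = x → p w = w → dist w x < δ →
      ∃ m, p m = m ∧ dist m x ≤ (1 + ε) * dist w x ∧ (1 - ε) * dist w x ≤ dist m x ∧
        (2 - ε) * dist w x ≤ dist m w := by
  obtain ⟨r, hr, hr1, hr2, hr3⟩ := exists_distortion hε
  obtain ⟨f, hfx, δ, hδ, hf, ρ, hρ, hsurj⟩ := hchart r hr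
  have hr0 : 0 < r := by linarith
  set A := 2 * r ^ 6 + 2 * r ^ 2 - 4 / r ^ 6 with hA
  have hAnn : 0 ≤ A := by
    have h6 : 1 ≤ r ^ 6 := one_le_pow₀ hr.le
    have h2 : 1 ≤ r ^ 2 := one_le_pow₀ hr.le
    have : 4 / r ^ 6 ≤ 4 := div_le_self (by norm_num) h6
    linarith
  refine ⟨min (δ / (r ^ 2 + 1)) (ρ / r), by positivity, fun p w hpx hpw hw => ?_⟩
  set s := dist w x with hs
  have hs0 : 0 ≤ s := dist_nonneg
  have hw1 : s * (r ^ 2 + 1) < δ := (lt_div_iff₀ (by positivity)).1 (hw.trans_le (min_le_left _ _))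
  have hw2 : s * r < ρ := (lt_div_iff₀ hr0).1 (hw.trans_le (min_le_right _ _))
  have hxb : x ∈ Metric.ball x δ := Metric.mem_ball_self hδ
  have hwb : w ∈ Metric.ball x δ := by
    rw [Metric.mem_ball]; nlinarith [sq_nonneg r]
  have hfw := hf x hxb w hwb
  rw [hfx, sub_zero, dist_comm, ← hs] at hfw
  -- `y` is the antipode of `w` in the chart.
  obtain ⟨y, hyb, hy⟩ := hsurj (-f w) (by rw [norm_neg]; linarith [hfw.1])
  have hyx := hf x hxb y hyb
  rw [hfx, sub_zero, hy, norm_neg, dist_comm] at hyx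
  have hyx1 : dist y x ≤ r ^ 2 * s := by
    have := mul_le_mul_of_nonneg_left hfw.1 hr0.le
    linarith [hyx.2]
  have hyx2 : s / r ^ 2 ≤ dist y x := by
    rw [div_le_iff₀ (by positivity)]
    have := mul_le_mul_of_nonneg_left hyx.1 hr0.le
    linarith [hfw.2]
  have hyw : 2 * s / r ^ 2 ≤ dist y w := by
    rw [div_le_iff₀ (by positivity)]
    have h1 := (hf y hyb w hwb).1
    rw [hy, sub_neg_eq_add, ← two_smul ℝ, norm_smul, Real.norm_ofNat] at h1
    have := mul_le_mul_of_nonneg_left h1 hr0.le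
    linarith [hfw.2]
  -- By the parallelogram law, a point with the same distances to `x` and `w` as `y` satisfies `‖f
  -- y' + f w‖² ≤ A s²`, where `A → 0` as `r → 1`. The orbit of `y` consists of such points, so it
  -- stays near `y` and `p` has a fixed point there.
  have hclose : ∀ y', dist y' x = dist y x → dist y' w = dist y w → dist y y' ≤ r * (√A * s) := by
    intro y' h1 h2
    have hy'b : y' ∈ Metric.ball x δ := by
      rw [Metric.mem_ball, h1]; exact Metric.mem_ball.1 hyb
    have n1 := (hf x hxb y' hy'b).1
    rw [hfx, sub_zero, dist_comm, h1] at n1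
    have n2 := (hf w hwb y' hy'b).2
    rw [dist_comm, h2] at n2
    have n3 : ‖f y'‖ ≤ r ^ 3 * s := by
      have := mul_le_mul_of_nonneg_left hyx1 hr0.le
      linarith
    have n4 : 2 * s / r ^ 3 ≤ ‖f y' - f w‖ := by
      rw [div_le_iff₀ (by positivity)]
      rw [div_le_iff₀ (by positivity)] at hyw
      have := mul_le_mul_of_nonneg_right n2 (sq_nonneg r)
      linarith
    have n5 : ‖f y' + f w‖ ^ 2 ≤ A * s ^ 2 := by
      have par := parallelogram_law_with_norm ℝ (f y') (f w)
      have q1 : ‖f y'‖ ^ 2 ≤ (r ^ 3 * s) ^ 2 := by gcongr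
      have q2 : ‖f w‖ ^ 2 ≤ (r * s) ^ 2 := by gcongr; exact hfw.1
      have q3 : (2 * s / r ^ 3) ^ 2 ≤ ‖f y' - f w‖ ^ 2 := by gcongr
      have q4 : (2 * s / r ^ 3) ^ 2 = 4 / r ^ 6 * s ^ 2 := by field_simp; ring
      rw [q4] at q3
      rw [hA]
      nlinarith
    have n6 : ‖f y' + f w‖ ≤ √A * s := by
      rw [← Real.sqrt_sq hs0, ← Real.sqrt_mul hAnn]
      exact Real.le_sqrt_of_sq_le n5
    have n7 := (hf y hyb y' hy'b).2
    rw [hy, sub_neg_eq_add] at n7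
    exact n7.trans (mul_le_mul_of_nonneg_left n6 hr0.le)
  obtain ⟨m, hm, hmy⟩ := hX.exists_fixed_near_orbit p (y := y) (r := r * (√A * s)) fun k => by
    refine hclose _ ?_ ?_
    · conv_lhs => rw [← zpow_apply_eq_self hpx k, (p ^ k).isometry.dist_eq]
    · conv_lhs => rw [← zpow_apply_eq_self hpw k, (p ^ k).isometry.dist_eq]
  have k1 := mul_le_mul_of_nonneg_right hr1 hs0
  have k2 := mul_le_mul_of_nonneg_right hr2 hs0
  have k3 := mul_le_mul_of_nonneg_right hr3 hs0
  have d1 : (1 / r ^ 2 - r * √A) * s = s / r ^ 2 - r * (√A * s) := by ring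
  have d2 : (2 / r ^ 2 - r * √A) * s = 2 * s / r ^ 2 - r * (√A * s) := by ring
  rw [d1] at k2
  rw [d2] at k3
  refine ⟨m, hm, ?_, ?_, ?_⟩
  · linarith [dist_triangle m y x]
  · linarith [dist_triangle y m x, dist_comm m y]
  · linarith [dist_triangle y m w, dist_comm m y]

/-- `X` is infinitesimally Euclidean at every point. -/
def InfinitesimallyEuclidean (X : Type*) [MetricSpace X] (V : X → Type*)
    [∀ x, NormedAddCommGroup (V x)] : Prop :=
  ∀ (x : X) (r : ℝ), 1 < r → ∃ f : X → V x, f x = 0 ∧ ∃ δ > 0,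
    (∀ a ∈ Metric.ball x δ, ∀ b ∈ Metric.ball x δ,
      ‖f b - f a‖ ≤ r * dist a b ∧ dist a b ≤ r * ‖f b - f a‖) ∧
    ∃ ρ > 0, ∀ v : V x, ‖v‖ < ρ → ∃ a ∈ Metric.ball x δ, f a = v

variable {W : X → Type*} [∀ x, NormedAddCommGroup (W x)] [∀ x, InnerProductSpace ℝ (W x)]

/-- The fixed point set of an isometry can be extended beyond any of its points, in the direction
opposite to another fixed point. -/
theorem IsCATNegOne.exists_fixed_extension [ProperSpace X] (hX : IsCATNegOne X)
    (hE : InfinitesimallyEuclidean X W) (p : X ≃ᵢ X) {x q : X} (hx : p x = x) (hq : p q = q)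
    (hne : x ≠ q) {ε η : ℝ} (hε : 0 < ε) (hη : 0 < η) :
    ∃ m, p m = m ∧ 0 < dist m x ∧ dist m x < η ∧
      dist x q + (1 - ε) * dist m x ≤ dist m q := by
  set T := dist x q with hT
  have hT0 : 0 < T := dist_pos.2 hne
  have hsT : 0 < Real.sinh T := Real.sinh_pos_iff.2 hT0
  have hsT2 : 0 < Real.sinh (T / 2) := Real.sinh_pos_iff.2 (by linarith)
  -- From `sinh 3s = 3 sinh s + 4 sinh³ s`: for `s ≤ 1` this is at most `C sinh s`. The choice of
  -- `ε'` absorbs `C` and the ratio of `sinh T` to `sinh (T/2)`.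
  set C := 3 + 4 * Real.sinh 1 ^ 2 with hC
  have hC0 : 0 < C := by positivity
  set ε' := min (1 / 2) (ε * Real.sinh (T / 2) / (4 * C * Real.sinh T)) with hε'
  have hε'0 : 0 < ε' := by positivity
  have hε'1 : ε' ≤ 1 / 2 := min_le_left _ _
  have hε'2 : ε' * (4 * C * Real.sinh T) ≤ ε * Real.sinh (T / 2) :=
    (le_div_iff₀ (by positivity)).1 (min_le_right _ _)
  obtain ⟨δ, hδ, h⟩ := hX.exists_fixed_antipode x (hE x) hε'0
  set s := min (min (δ / 2) (η / 2)) (min (T / 4) 1) with hs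
  have hs0 : 0 < s := by positivity
  have s1 : s ≤ δ / 2 := (min_le_left _ _).trans (min_le_left _ _)
  have s2 : s ≤ η / 2 := (min_le_left _ _).trans (min_le_right _ _)
  have s3 : s ≤ T / 4 := (min_le_right _ _).trans (min_le_left _ _)
  have s4 : s ≤ 1 := (min_le_right _ _).trans (min_le_right _ _)
  obtain ⟨w, hw1, hw2⟩ := hX.exists_between x q (a := s) hs0.le (by linarith)
  have hpw : p w = w := hX.map_eq_of_fixed p hx hq (by linarith)
  have hwx : dist w x = s := by rw [dist_comm, hw1]
  obtain ⟨m, hm, m1, m2, m3⟩ := h p w hx hpw (by linarith)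
  rw [hwx] at m1 m2 m3
  set σ := dist m x with hσ
  set D := dist m q with hD
  have σ0 := mul_le_mul_of_nonneg_right hε'1 hs0.le
  have σ1 : σ ≤ 3 / 2 * s := by linarith
  have σ2 : s ≤ 2 * σ := by linarith
  refine ⟨m, hm, by linarith, by linarith, ?_⟩
  have hst := hX.stewart m (x := x) (y := q) (m := w) (by linarith)
  rw [hw1, hw2, ← hT, ← hσ, ← hD] at hst
  -- Stewart's identity for collinear points at positions `-σ, 0, s, T`. Subtracting the inequality
  -- for `m, x, w, q` turns the small defect `σ + s - d(m, w) ≤ 2ε's` into a bound on `cosh (σ + T)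
  -- - cosh D`; tangent lines of cosh convert between the two.
  have hid : Real.cosh (σ + s) * Real.sinh T =
      Real.sinh (T - s) * Real.cosh σ + Real.sinh s * Real.cosh (σ + T) := by
    rw [Real.cosh_add, Real.cosh_add, Real.sinh_sub]
    ring
  have c1 := Real.cosh_add_sinh_mul_sub_le (σ + s) (dist m w)
  have c2 := Real.cosh_add_sinh_mul_sub_le D (σ + T)
  have hss : 0 < Real.sinh s := Real.sinh_pos_iff.2 hs0
  have c3 : Real.sinh (σ + s) ≤ C * Real.sinh s := by
    have e1 : Real.sinh (σ + s) ≤ Real.sinh (3 * s) := Real.sinh_le_sinh.2 (by linarith)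
    rw [Real.sinh_three_mul] at e1
    have e2 : Real.sinh s ≤ Real.sinh 1 := Real.sinh_le_sinh.2 s4
    have e3 : Real.sinh s ^ 2 ≤ Real.sinh 1 ^ 2 := by gcongr
    have e4 := mul_le_mul_of_nonneg_right e3 hss.le
    rw [hC]
    linarith
  have c4 : Real.sinh (σ + s) * (σ + s - dist m w) ≤ C * Real.sinh s * (2 * ε' * s) := by
    have e0 : 0 ≤ Real.sinh (σ + s) := Real.sinh_nonneg_iff.2 (by linarith)
    calc _ ≤ Real.sinh (σ + s) * (2 * ε' * s) := mul_le_mul_of_nonneg_left (by linarith) e0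
      _ ≤ _ := mul_le_mul_of_nonneg_right c3 (by positivity)
  have c5 : Real.sinh s * (Real.cosh (σ + T) - Real.cosh D) ≤
      Real.sinh s * (C * (2 * ε' * s) * Real.sinh T) := by
    have := mul_le_mul_of_nonneg_right
      (show Real.cosh (σ + s) - Real.cosh (dist m w) ≤ C * Real.sinh s * (2 * ε' * s) by linarith)
      hsT.le
    linarith
  have c6 := le_of_mul_le_mul_left c5 hss
  have hDT : T / 2 ≤ D := by linarith [dist_triangle x m q, dist_comm x m]
  have hDT2 : 0 ≤ σ + T - D := by linarith [dist_triangle m x q]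
  have c7 : Real.sinh (T / 2) * (σ + T - D) ≤ Real.sinh D * (σ + T - D) :=
    mul_le_mul_of_nonneg_right (Real.sinh_le_sinh.2 hDT) hDT2
  have c8 : Real.sinh (T / 2) * (σ + T - D) ≤ Real.sinh (T / 2) * (ε * σ) := by
    have e1 : C * (2 * ε' * s) * Real.sinh T ≤ C * (2 * ε' * (2 * σ)) * Real.sinh T := by gcongr
    have e2 := mul_le_mul_of_nonneg_right hε'2 (show 0 ≤ σ by linarith)
    linarith
  have c9 := le_of_mul_le_mul_left c8 hsT2
  linarith

/-- Maximize the distance to `q` over the compact set `A` of fixed points with the required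
inequality. A maximum before distance `R` could be extended further away from `q`, and the
inequalities add up. -/
theorem IsCATNegOne.exists_fixed_at_dist [ProperSpace X] (hX : IsCATNegOne X)
    (hE : InfinitesimallyEuclidean X W) (p : X ≃ᵢ X) {x q : X} (hx : p x = x) (hq : p q = q)
    (hne : x ≠ q) {ε R : ℝ} (hε : 0 < ε) (hε1 : ε < 1) (hR : 0 ≤ R) :
    ∃ m, p m = m ∧ dist m x = R ∧ dist x q + (1 - ε) * R ≤ dist m q := by
  set A : Set X := {m | p m = m ∧ dist m x ≤ R ∧ dist x q + (1 - ε) * dist m x ≤ dist m q} with hA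
  have hAc : IsCompact A := by
    refine (isCompact_closedBall x R).of_isClosed_subset ?_ fun m hm => hm.2.1
    refine (isClosed_eq p.continuous continuous_id).inter
      ((isClosed_le (continuous_id.dist continuous_const) continuous_const).inter
        (isClosed_le ?_ (continuous_id.dist continuous_const)))
    exact continuous_const.add (continuous_const.mul (continuous_id.dist continuous_const))
  have hxA : x ∈ A := ⟨hx, by simpa using hR, by simp⟩
  obtain ⟨m, hmA, hmax⟩ := hAc.exists_isMaxOn ⟨x, hxA⟩
    (continuous_id.dist (continuous_const (y := q))).continuousOn
  obtain ⟨m1, m2, m3⟩ := hmA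
  have hT0 : 0 < dist x q := dist_pos.2 hne
  have hd0 : 0 ≤ (1 - ε) * dist m x := mul_nonneg (by linarith) dist_nonneg
  rcases m2.eq_or_lt with h | h
  · exact ⟨m, m1, h, by rw [← h]; exact m3⟩
  · exfalso
    have hmq : m ≠ q := dist_pos.1 (by linarith)
    obtain ⟨m', e1, e2, e3, e4⟩ := hX.exists_fixed_extension hE p m1 hq hmq hε
      (η := R - dist m x) (by linarith)
    have htri := dist_triangle m' m x
    have hε2 : 0 < (1 - ε) * dist m' m := mul_pos (by linarith) e2
    have hm'A : m' ∈ A := by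
      refine ⟨e1, by linarith, ?_⟩
      have := mul_le_mul_of_nonneg_left htri (show 0 ≤ 1 - ε by linarith)
      linarith
    have := hmax hm'A
    simp only [Set.mem_ofPred_eq, id] at this
    linarith

/-- The fixed points at distance `n` carry a total error `n / (n + 2)²`, which tends to 0, so in the
limit the ray prolongs the segment from `q` to `x` exactly. Points between two fixed points are
fixed, and this passes to the limit. -/
theorem IsCATNegOne.exists_fixed_opposite_ray [ProperSpace X] (hX : IsCATNegOne X)
    (hE : InfinitesimallyEuclidean X W) (p : X ≃ᵢ X) {x q : X} (hx : p x = x) (hq : p q = q)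
    (hne : x ≠ q) : ∃ c : GeodesicRay X, c.1 0 = x ∧ (∀ t, p (c.1 t) = c.1 t) ∧
      ∀ t : ℝ≥0, dist x q + t ≤ dist (c.1 t) q := by
  have hpos : ∀ n : ℕ, 0 < 1 / ((n : ℝ) + 2) ^ 2 := fun n => by positivity
  have hlt : ∀ n : ℕ, 1 / ((n : ℝ) + 2) ^ 2 < 1 := fun n => by
    have hn : (0 : ℝ) ≤ n := n.cast_nonneg
    rw [div_lt_one (by positivity)]; nlinarith
  choose y y1 y2 y3 using fun n : ℕ => hX.exists_fixed_at_dist hE p hx hq hne (hpos n) (hlt n)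
    (R := n) n.cast_nonneg
  have hy : Tendsto (fun n => dist x (y n)) atTop atTop := by
    simp only [dist_comm x, y2]
    exact tendsto_natCast_atTop_atTop
  obtain ⟨c, g, hc, hg⟩ := hX.exists_limit_ray x hy
  have hle : ((hyperfilter ℕ : Ultrafilter ℕ) : Filter ℕ) ≤ atTop := Nat.hyperfilter_le_atTop
  refine ⟨c, hc, fun t => ?_, fun t => ?_⟩
  · have l1 := (p.continuous.tendsto _).comp (hg t).2
    refine tendsto_nhds_unique (l1.congr' ?_) (hg t).2
    filter_upwards [hle (hg t).1] with n hn
    exact hX.map_eq_of_fixed p hx (y1 n) (by rw [hn.1, hn.2]; ring)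
  · have l1 : Tendsto (fun n => dist (g n t) q) (hyperfilter ℕ) (𝓝 (dist (c.1 t) q)) :=
      (hg t).2.dist tendsto_const_nhds
    have l2 : Tendsto (fun n : ℕ => dist x q + t - 1 / ((n : ℝ) + 1)) (hyperfilter ℕ)
        (𝓝 (dist x q + t - 0)) :=
      (tendsto_const_nhds.sub tendsto_one_div_add_atTop_nhds_zero_nat).mono_left hle
    rw [sub_zero] at l2
    refine le_of_tendsto_of_tendsto l2 l1 ?_
    filter_upwards [hle (hg t).1] with n hn
    have e1 := y3 n
    have e2 := dist_triangle (y n) (g n t) q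
    rw [dist_comm (y n) (g n t), hn.2, dist_comm x, y2] at e2
    have e3 : 1 / ((n : ℝ) + 2) ^ 2 * n ≤ 1 / ((n : ℝ) + 1) := by
      have hn : (0 : ℝ) ≤ n := n.cast_nonneg
      rw [one_div_mul_eq_div, div_le_div_iff₀ (by positivity) (by positivity)]
      nlinarith
    linarith

/-- A parabolic isometry has no fixed point. -/
theorem IsCATNegOne.apply_ne_of_isParabolicIsometry [ProperSpace X] (hX : IsCATNegOne X)
    (hE : InfinitesimallyEuclidean X W) {p : X ≃ᵢ X} (hp : IsParabolicIsometry p) (x : X) :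
    p x ≠ x := by
  intro hx
  obtain ⟨η, hη, huniq⟩ := hp
  obtain ⟨c, hc0, hcη⟩ := hX.exists_ray x η
  -- `p` fixes the origin and the endpoint of this ray, hence every point of it.
  have hmap : c.map p = c := by
    refine hX.ray_eq ?_ ?_
    · show p (c.1 0) = c.1 0
      rw [hc0, hx]
    · rw [GeodesicRay.endpoint_map, hcη]; exact hη
  have hfix : ∀ t, p (c.1 t) = c.1 t := fun t =>
    congrArg (fun b : GeodesicRay X => b.1 t) hmap
  have hd : dist x (c.1 1) = 1 := by rw [← hc0, dist_comm, c.dist_zero]; simp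
  obtain ⟨b, hb0, hbfix, hb⟩ := hX.exists_fixed_opposite_ray hE p hx (hfix 1)
    (dist_pos.1 (by rw [hd]; exact one_pos))
  have hbmap : b.map p = b := Subtype.ext (funext hbfix)
  have hbη : b.endpoint = η := by
    refine huniq _ ?_
    show p • b.endpoint = b.endpoint
    rw [← GeodesicRay.endpoint_map, hbmap]
  -- Uniqueness of `η` identifies the two rays, yet `b 1` should be at distance at least 2 from `c
  -- 1`.
  have hbc : b = c := hX.ray_eq (by rw [hb0, hc0]) (by rw [hbη, hcη])
  have := hb 1
  rw [hbc, dist_self, hd] at this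
  norm_num at this

/-- The displacement of the powers of a parabolic isometry tends to infinity. -/
theorem IsCATNegOne.tendsto_dist_pow [ProperSpace X] (hX : IsCATNegOne X)
    (hE : InfinitesimallyEuclidean X W) {p : X ≃ᵢ X} (hp : IsParabolicIsometry p) (o : X) :
    Tendsto (fun k : ℕ => dist o ((p ^ k) o)) atTop atTop := by
  by_contra hcon
  obtain ⟨C, hC⟩ := exists_dist_pow_le_of_not_tendsto p o hcon
  have hC' : ∀ k : ℤ, dist o ((p ^ k) o) ≤ C := by
    intro k
    rcases Int.eq_nat_or_neg k with ⟨n, rfl | rfl⟩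
    · simpa using hC n
    · have := dist_zpow_apply p o (-n) 0
      rw [zero_sub, neg_neg] at this
      rw [dist_comm]
      simp only [zpow_zero, zpow_natCast] at this
      exact this.le.trans (hC n)
  obtain ⟨m, hm, -⟩ := hX.exists_fixed_near_orbit p hC'
  exact hX.apply_ne_of_isParabolicIsometry hE hp m hm

end Riemannian

end FixedPoints

/-! ### The critical exponent of a cyclic group -/

section CriticalExponent

variable {X : Type*} [MetricSpace X]

theorem zpow_injective_of_tendsto {p : X ≃ᵢ X} {o : X}
    (h : Tendsto (fun k : ℕ => dist o ((p ^ k) o)) atTop atTop) :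
    Function.Injective fun k : ℤ => p ^ k := by
  rw [injective_zpow_iff_not_isOfFinOrder, isOfFinOrder_iff_pow_eq_one]
  rintro ⟨n, hn, hpn⟩
  have h2 : Tendsto (fun k : ℕ => dist o ((p ^ (n * k)) o)) atTop atTop :=
    h.comp (tendsto_id.const_mul_atTop' hn)
  simp only [pow_mul, hpn, one_pow] at h2
  obtain ⟨k, hk⟩ := (h2.eventually_gt_atTop 0).exists
  simp at hk

/-- Divergence gives `p` infinite order, so the group is indexed by `ℤ`; negative powers contribute
the same terms because `d(o, p^(-n) o) = d(o, p^n o)`. -/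
theorem summable_zpowers_iff {p : X ≃ᵢ X} {o : X}
    (h : Tendsto (fun k : ℕ => dist o ((p ^ k) o)) atTop atTop) (s : ℝ) :
    Summable (fun g : Subgroup.zpowers p => Real.exp (-s * dist o ((g : X ≃ᵢ X) o))) ↔
      Summable fun k : ℕ => Real.exp (-s * dist o ((p ^ k) o)) := by
  have hinj := zpow_injective_of_tendsto h
  let f : ℤ → Subgroup.zpowers p := fun k => ⟨p ^ k, Subgroup.zpow_mem_zpowers p k⟩
  have hf : Function.Bijective f :=
    ⟨fun i j hij => hinj (congrArg Subtype.val hij), by rintro ⟨_, k, rfl⟩; exact ⟨k, rfl⟩⟩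
  rw [← (Equiv.ofBijective f hf).summable_iff]
  change Summable (fun k : ℤ => Real.exp (-s * dist o ((p ^ k) o))) ↔ _
  constructor
  · intro hs
    exact (hs.comp_injective (i := fun n : ℕ => (n : ℤ)) Nat.cast_injective).congr fun n => by
      simp only [Function.comp_apply, zpow_natCast]
  · intro hs
    refine Summable.of_nat_of_neg (hs.congr fun n => ?_) (hs.congr fun n => ?_)
    · simp only [zpow_natCast]
    · have := dist_zpow_apply p o (-n) 0
      rw [zero_sub, neg_neg] at this
      simp only [zpow_zero, zpow_natCast] at this
      rw [dist_comm o ((p ^ (-(n : ℤ))) o)]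
      exact congrArg (fun t => Real.exp (-s * t)) this.symm

/-- If `g k` is at bounded distance from `d k → ∞`, the critical exponent of `∑ exp (-s d k)` is at
least the lower limit of `log k / g k`. -/
theorem liminf_log_div_le {d g : ℕ → ℝ} {K : ℝ} (hd : Tendsto d atTop atTop)
    (hg : ∀ k, |g k - d k| ≤ K) {s : ℝ} (hs : Summable fun k => Real.exp (-s * d k)) :
    liminf (fun k : ℕ => ((Real.log k / g k : ℝ) : EReal)) atTop ≤ s := by
  by_contra hcon
  push Not at hcon
  have hev := eventually_lt_of_lt_liminf hcon
  refine Real.not_summable_natCast_inv ?_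
  -- If `s` is below the lower limit, eventually `s * g k < log k`, so the terms dominate `1/k` up
  -- to a constant. The absolute value in `|s| * K` allows negative `s`.
  have hs' := hs.mul_left (Real.exp (|s| * K))
  refine hs'.of_norm_bounded_eventually_nat ?_
  filter_upwards [hev, hd.eventually_gt_atTop K, eventually_gt_atTop 0] with k h1 h2 h3
  have h4 := abs_le.1 (hg k)
  have hgk : 0 < g k := by linarith
  have hk : (0 : ℝ) < k := by exact_mod_cast h3
  rw [EReal.coe_lt_coe_iff, lt_div_iff₀ hgk] at h1
  have h5 : s * d k ≤ s * g k + |s| * K := by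
    have : s * (d k - g k) ≤ |s| * K := by
      refine (le_abs_self _).trans ?_
      rw [abs_mul, abs_sub_comm]
      exact mul_le_mul_of_nonneg_left (hg k) (abs_nonneg s)
    linarith
  rw [norm_inv, Real.norm_natCast, ← Real.exp_add]
  have h6 : (k : ℝ)⁻¹ = Real.exp (-Real.log k) := by rw [Real.exp_neg, Real.exp_log hk]
  rw [h6, Real.exp_le_exp]
  linarith

/-- For `s'` between the upper limit and `s`, eventually `log k < s' * g k`, so `exp (-s d k)` is at
most a constant times `k^(-s/s')`, with `s/s' > 1`. -/
theorem summable_of_limsup_log_div_lt {d g : ℕ → ℝ} {K : ℝ} (hd : Tendsto d atTop atTop)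
    (hg : ∀ k, |g k - d k| ≤ K) {s : ℝ}
    (hs : limsup (fun k : ℕ => ((Real.log k / g k : ℝ) : EReal)) atTop < s) :
    Summable fun k => Real.exp (-s * d k) := by
  obtain ⟨s', hs1, hs2⟩ := EReal.lt_iff_exists_real_btwn.1 hs
  rw [EReal.coe_lt_coe_iff] at hs2
  have hev := eventually_lt_of_limsup_lt hs1
  -- The ratios are eventually nonnegative, hence so is every strict upper bound, which is then
  -- positive.
  have hs'0 : 0 < s' := by
    obtain ⟨k, h1, h2, h3⟩ := (hev.and ((hd.eventually_gt_atTop K).and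
      (eventually_gt_atTop 0))).exists
    have h4 := abs_le.1 (hg k)
    rw [EReal.coe_lt_coe_iff] at h1
    exact (div_nonneg (Real.log_natCast_nonneg k) (by linarith)).trans_lt h1
  have hsum : Summable fun k : ℕ => Real.exp (s * K) * (k : ℝ) ^ (-(s / s')) :=
    (Real.summable_nat_rpow.2 (by rw [neg_lt_neg_iff, one_lt_div hs'0]; exact hs2)).mul_left _
  refine hsum.of_norm_bounded_eventually_nat ?_
  filter_upwards [hev, hd.eventually_gt_atTop K, eventually_gt_atTop 0] with k h1 h2 h3
  have h4 := abs_le.1 (hg k)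
  have hgk : 0 < g k := by linarith
  have hk : (0 : ℝ) < k := by exact_mod_cast h3
  rw [EReal.coe_lt_coe_iff, div_lt_iff₀ hgk] at h1
  rw [Real.norm_eq_abs, abs_of_pos (Real.exp_pos _), Real.rpow_def_of_pos hk, ← Real.exp_add,
    Real.exp_le_exp]
  have h5 : Real.log k * (s / s') ≤ s * (d k + K) := by
    have e1 : Real.log k ≤ s' * (d k + K) :=
      h1.le.trans (mul_le_mul_of_nonneg_left (by linarith) hs'0.le)
    have e2 := mul_le_mul_of_nonneg_right e1 (div_pos (hs'0.trans hs2) hs'0).le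
    have e3 : s' * (d k + K) * (s / s') = s * (d k + K) := by field_simp
    linarith
  linarith

end CriticalExponent

/-! ### The critical exponent and the visual ratio -/

theorem proposition3p5 {X : Type*} [MetricSpace X] [CompleteSpace X]
    [ChartedSpace (EuclideanSpace ℝ (Fin 2)) X] [IsManifold (𝓡 2) ∞ X]
    [RiemannianBundle (fun x : X => TangentSpace (𝓡 2) x)]
    [IsContMDiffRiemannianBundle (𝓡 2) ∞ (EuclideanSpace ℝ (Fin 2))
      (fun x : X => TangentSpace (𝓡 2) x)]
    [IsRiemannianManifold (𝓡 2) X]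
    (hX : IsCATNegOne X) (o : X) (p : X ≃ᵢ X) (hp : IsParabolicIsometry p)
    (ξ : GromovBoundary X) (hξ : p • ξ ≠ ξ) :
    (liminf (fun k : ℕ => (visualRatio o p ξ k : EReal)) atTop
        ≤ criticalExponent o (Subgroup.zpowers p) ∧
      criticalExponent o (Subgroup.zpowers p)
        ≤ limsup (fun k : ℕ => (visualRatio o p ξ k : EReal)) atTop) ∧
    ∀ L : EReal, Tendsto (fun k : ℕ => (visualRatio o p ξ k : EReal)) atTop (𝓝 L) →
      L = criticalExponent o (Subgroup.zpowers p) := by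
  have : LocallyCompactSpace X := ChartedSpace.locallyCompactSpace (EuclideanSpace ℝ (Fin 2)) X
  have : ProperSpace X := hX.properSpace
  have hE : InfinitesimallyEuclidean X (fun x : X => TangentSpace (𝓡 2) x) := fun x r hr =>
    exists_almost_isometric_chart (E := EuclideanSpace ℝ (Fin 2)) x hr
  have hd := hX.tendsto_dist_pow hE hp o
  obtain ⟨K, hK⟩ := hX.gromovHyperbolic.abs_gromovProduct_pow_sub_dist_le
    (fun _ _ h => hX.exists_liesOnGeodesic h) o p hξ
  have hratio : ∀ k : ℕ, visualRatio o p ξ k =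
      Real.log k / gromovProduct o (p ^ k • ξ) (p ^ (k + 1) • ξ) := by
    intro k
    -- Consecutive orbit points are distinct, so the value 0 of the visual distance on the diagonal
    -- does not occur and the logarithm cancels the exponential.
    have hne : p ^ k • ξ ≠ p ^ (k + 1) • ξ := by
      rw [pow_succ, mul_smul]
      exact fun h => hξ (smul_left_cancel _ h).symm
    simp [visualRatio, visualDist, hne]
  simp only [hratio]
  have hlow : liminf (fun k : ℕ =>
      ((Real.log k / gromovProduct o (p ^ k • ξ) (p ^ (k + 1) • ξ) : ℝ) : EReal)) atTop
        ≤ criticalExponent o (Subgroup.zpowers p) := by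
    refine le_sInf ?_
    rintro _ ⟨s, hs, rfl⟩
    exact liminf_log_div_le hd hK ((summable_zpowers_iff hd s).1 hs)
  have hup : criticalExponent o (Subgroup.zpowers p) ≤ limsup (fun k : ℕ =>
      ((Real.log k / gromovProduct o (p ^ k • ξ) (p ^ (k + 1) • ξ) : ℝ) : EReal)) atTop := by
    by_contra hcon
    push Not at hcon
    obtain ⟨s, hs1, hs2⟩ := EReal.lt_iff_exists_real_btwn.1 hcon
    refine hs2.not_ge (sInf_le ⟨s, ?_, rfl⟩)
    exact (summable_zpowers_iff hd s).2 (summable_of_limsup_log_div_lt hd hK hs1)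
  refine ⟨⟨hlow, hup⟩, fun L hL => ?_⟩
  rw [hL.liminf_eq] at hlow
  rw [hL.limsup_eq] at hup
  exact le_antisymm hlow hup
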